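/- Let $m\ge 0$ be an integer and let $\mathcal A_m=\mathbb Z[x]/(x^m)$, graded by $\deg x=1$. Let $G$ be a finite graph (loops and multiple edges allowed) with vertex set $V$ and edge set $E$, the latter with a fixed linear order. For $s\subseteq E$ let $[G:s]$ be the graph with vertex set $V$ and edge set $s$, and let $C^i(G)=\bigoplus_{|s|=i}\mathcal A_m^{\otimes \pi_0([G:s])}$, one tensor factor (over $\mathbb Z$) for each connected component of $[G:s]$, graded by total degree. The differential $d^i:C^i(G)\to C^{i+1}(G)$ is the sum, over all $s\subseteq E$ with $|s|=i$ and all $e\in E\setminus s$, of $(-1)^{\#\{f\in s\,:\,f<e\}}$ times the map from the summand of $s$ to the summand of $s\cup\{e\}$ that multiplies the two tensor factors belonging to the components joined by $e$ if $e$ joins two different components of $[G:s]$, and is the identity otherwise. It preserves degree. For integers $i,j\ge 0$, let $H^{i,j}_{\mathcal A_m}(G)$ be the degree $j$ part of the $i$-th cohomology group of this cochain complex, and let $\mathrm{Tor}(H)$ denote the torsion subgroup of an abelian group $H$. Suppose that $G$ has $v$ vertices, $\mu$ connected components and no isolated vertices (every vertex is incident with an edge). Then, for all $i,j\ge 0$: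 1. If $H^{i,j}_{\mathcal A_m}(G)\neq 0$, then $0\le i\le v-2\mu$, $\ i+j\ge v-\mu$, and $(m-1)i+j\le (m-1)v$. 2. If $\mathrm{Tor}(H^{i,j}_{\mathcal A_m}(G))\neq 0$, then $1\le i\le v-2\mu$, $\ i+j\ge v-\mu+1$, and $(m-1)i+j\le (m-1)v$. -/

import Mathlib

open scoped TensorProduct Polynomial Graph

noncomputable section

namespace ChromaticCohomology

/-! ### Connected components of a multigraph -/

section Components

variable {α β : Type*}

/-- The connected components of a multigraph: the quotient of the vertex set by the equivalence
relation generated by adjacency. -/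
def Component (G : Graph α β) : Type _ :=
  Quot fun x y : V(G) => G.Adj (x : α) (y : α)

instance (G : Graph α β) [Finite V(G)] : Finite (Component G) :=
  inferInstanceAs (Finite (Quot _))

instance (G : Graph α β) [Finite V(G)] : Fintype (Component G) := Fintype.ofFinite _

instance (G : Graph α β) : DecidableEq (Component G) := Classical.decEq _

/-- A vertex is isolated if no edge is incident with it. -/
def IsIsolated (G : Graph α β) (x : α) : Prop := x ∈ V(G) ∧ ∀ e, ¬ G.Inc e x

/-- For sets of edges `s ⊆ t`, the map sending a component of the spanning subgraph `[G : s]`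
to the component of `[G : t]` that contains it. -/
def Component.incl (G : Graph α β) {s t : Set β} (h : s ⊆ t) :
    Component (G.restrict s) → Component (G.restrict t) :=
  Quot.map id fun _ _ hxy => by
    obtain ⟨e, he⟩ := hxy
    exact ⟨e, h he.1, he.2⟩

theorem Component.incl_incl (G : Graph α β) {s t u : Set β} (h : s ⊆ t) (h' : t ⊆ u)
    (c : Component (G.restrict s)) :
    Component.incl G h' (Component.incl G h c) = Component.incl G (h.trans h') c := by
  induction c using Quot.ind
  rfl

end Components

/-! ### Tensor powers of an algebra -/

section Tensor

variable {A : Type*} [CommRing A]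
variable {ι κ l : Type*} [Fintype ι] [DecidableEq κ] [DecidableEq l]

theorem fiberProd_update [DecidableEq ι] (f : ι → κ) (a : ι → A) (i : ι) (x : A) :
    (fun k => ∏ c with f c = k, Function.update a i x c) =
      Function.update (fun k => ∏ c with f c = k, a c) (f i)
        (x * ∏ c ∈ (Finset.univ.filter fun c => f c = f i) \ {i}, a c) := by
  funext k
  by_cases hk : k = f i
  · subst hk
    rw [Function.update_self, Finset.prod_update_of_mem (by simp)]
  · rw [Function.update_of_ne hk, Finset.prod_update_of_notMem]
    simpa using fun h => hk h.symm

variable (A) in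
/-- The linear map `A^{⊗ ι} → A^{⊗ κ}` induced by a map `f : ι → κ` of index sets: it multiplies
together all tensor factors whose indices have the same image under `f`, that is,
`⊗_c a_c ↦ ⊗_k ∏_{f c = k} a_c`. -/
def mergeMap (f : ι → κ) : (⨂[ℤ] _ : ι, A) →ₗ[ℤ] ⨂[ℤ] _ : κ, A :=
  PiTensorProduct.lift
    { toFun := fun a => PiTensorProduct.tprod ℤ fun k => ∏ c with f c = k, a c
      map_update_add' := by
        intro _ a i x y
        rw [fiberProd_update, fiberProd_update, fiberProd_update, add_mul,
          MultilinearMap.map_update_add]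
      map_update_smul' := by
        intro _ a i r x
        rw [fiberProd_update, fiberProd_update, smul_mul_assoc,
          MultilinearMap.map_update_smul] }

theorem mergeMap_tprod (f : ι → κ) (a : ι → A) :
    mergeMap A f (PiTensorProduct.tprod ℤ a) =
      PiTensorProduct.tprod ℤ fun k => ∏ c with f c = k, a c := by
  simp [mergeMap]

theorem mergeMap_mergeMap [Fintype κ] (f : ι → κ) (g : κ → l) (z : ⨂[ℤ] _ : ι, A) :
    mergeMap A g (mergeMap A f z) = mergeMap A (g ∘ f) z := by
  induction z using PiTensorProduct.induction_on with
  | smul_tprod r a =>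
    simp only [map_smul, mergeMap_tprod]
    congr 2
    funext k
    rw [Finset.prod_sigma']
    refine Finset.prod_bij' (fun p _ => p.2) (fun c _ => ⟨f c, c⟩) ?_ ?_ ?_ ?_ ?_ <;> aesop
  | add x y hx hy => simp only [map_add, hx, hy]

/-- The degree `j` part of `A^{⊗ ι}` for a graded ring `A = ⨁ 𝒜 d`: it is spanned by the tensors
of homogeneous elements whose degrees add up to `j`. -/
def tensorDegree (𝒜 : ℕ → Submodule ℤ A) (ι : Type*) [Fintype ι] (j : ℕ) :
    Submodule ℤ (⨂[ℤ] _ : ι, A) :=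
  Submodule.span ℤ {z | ∃ (d : ι → ℕ) (a : ι → A),
    (∀ c, a c ∈ 𝒜 (d c)) ∧ ∑ c, d c = j ∧ PiTensorProduct.tprod ℤ a = z}

theorem mergeMap_mem_tensorDegree [Fintype κ] (𝒜 : ℕ → Submodule ℤ A) [SetLike.GradedMonoid 𝒜] (f : ι → κ)
    {j : ℕ} {z : ⨂[ℤ] _ : ι, A} (hz : z ∈ tensorDegree 𝒜 ι j) :
    mergeMap A f z ∈ tensorDegree 𝒜 κ j := by
  induction hz using Submodule.span_induction with
  | mem z hz =>
    obtain ⟨d, a, ha, hd, rfl⟩ := hz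
    rw [mergeMap_tprod]
    refine Submodule.subset_span ⟨fun k => ∑ c with f c = k, d c, _, fun k => ?_, ?_, rfl⟩
    · exact SetLike.prod_mem_graded 𝒜 _ _ fun c _ => ha c
    · rw [← hd]
      exact Finset.sum_fiberwise _ _ _
  | zero => simp
  | add x y _ _ hx hy => simpa using Submodule.add_mem _ hx hy
  | smul r x _ hx =>
    rw [map_smul]
    exact Submodule.smul_mem _ r hx

end Tensor

/-! ### The chromatic cochain complex of a multigraph -/

section Complex

variable {α β : Type*} (G : Graph α β) [Finite V(G)]
variable {A : Type*} [CommRing A]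

/-- The sets of `i` edges of `G`, i.e. the vertices of height `i` of the cube `{0,1}^E`. -/
abbrev State (i : ℕ) : Type _ := {s : Finset β // (s : Set β) ⊆ E(G) ∧ s.card = i}

variable (A) in
/-- `C^i(G) = ⨁_{|s| = i} A^{⊗ components of [G : s]}`, a finite direct sum. -/
abbrev Cochain (i : ℕ) : Type _ :=
  (s : State G i) → ⨂[ℤ] _ : Component (G.restrict (s.1 : Set β)), A

instance (s : Set β) : Finite V(G.restrict s) := inferInstanceAs (Finite V(G))

variable (A) in
/-- The per-edge map `A^{⊗ components of [G : s]} → A^{⊗ components of [G : t]}` for `s ⊆ t`.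
When `t = s ∪ {e}`, this is the multiplication of the two factors of the components joined
by `e` if `e` joins two different components, and the canonical identification otherwise. -/
def edgeMap {s t : Set β} (h : s ⊆ t) :
    (⨂[ℤ] _ : Component (G.restrict s), A) →ₗ[ℤ] ⨂[ℤ] _ : Component (G.restrict t), A :=
  mergeMap A (Component.incl G h)

theorem edgeMap_edgeMap {s t u : Set β} (h : s ⊆ t) (h' : t ⊆ u)
    (z : ⨂[ℤ] _ : Component (G.restrict s), A) :
    edgeMap G A h' (edgeMap G A h z) = edgeMap G A (h.trans h') z := by
  simp only [edgeMap, mergeMap_mergeMap]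
  congr 2
  funext c
  exact Component.incl_incl G h h' c

theorem edgeMap_congr {i : ℕ} (c : Cochain G A i) {s s' : State G i} (hs : s = s') {t : Set β}
    (h : (s.1 : Set β) ⊆ t) (h' : (s'.1 : Set β) ⊆ t) :
    edgeMap G A h (c s) = edgeMap G A h' (c s') := by
  subst hs
  rfl

variable [LinearOrder β]

variable {G} in
/-- The state obtained by removing the edge `e`. -/
def State.erase {i : ℕ} (t : State G (i + 1)) (e : {e // e ∈ t.1}) : State G i :=
  ⟨t.1.erase e, (Finset.coe_subset.2 (Finset.erase_subset _ _)).trans t.2.1, by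
    rw [Finset.card_erase_of_mem e.2, t.2.2, Nat.add_sub_cancel]⟩

/-- The sign of the edge of the cube from `t \ {e}` to `t`: it is `-1` to the power of the number
of edges in `t` that come before `e`. -/
def sign (t : Finset β) (e : β) : ℤ := (-1) ^ (t.filter (· < e)).card

variable (A) in
/-- The differential `d^i : C^i(G) → C^{i+1}(G)`: its component at `t` is the signed sum of the
per-edge maps out of `t \ {e}`, over all `e ∈ t`. -/
def d (i : ℕ) : Cochain G A i →ₗ[ℤ] Cochain G A (i + 1) :=
  LinearMap.pi fun t => ∑ e : {e // e ∈ t.1},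
    sign t.1 e • edgeMap G A (s := ((t.erase e).1 : Set β))
      (Finset.coe_subset.2 (Finset.erase_subset _ _)) ∘ₗ LinearMap.proj (t.erase e)

/-- `C^{i,j}(G)`: the homogeneous cochains of degree `j`. -/
def cochainDegree (𝒜 : ℕ → Submodule ℤ A) (i j : ℕ) : Submodule ℤ (Cochain G A i) :=
  Submodule.pi Set.univ fun s => tensorDegree 𝒜 (Component (G.restrict (s.1 : Set β))) j

/-- The cocycles in `C^{i,j}(G)`. -/
def cocycles (𝒜 : ℕ → Submodule ℤ A) (i j : ℕ) : Submodule ℤ (Cochain G A i) :=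
  cochainDegree G 𝒜 i j ⊓ LinearMap.ker (d G A i)

/-- The coboundaries in `C^{i,j}(G)`: the image of `C^{i-1,j}(G)`, where `C^{-1,j}(G) = 0`. -/
def coboundaries (𝒜 : ℕ → Submodule ℤ A) : (i j : ℕ) → Submodule ℤ (Cochain G A i)
  | 0, _ => ⊥
  | i + 1, j => (cochainDegree G 𝒜 i j).map (d G A i)

/-- The chromatic cohomology group `H^{i,j}_A(G)`. -/
abbrev Cohomology (𝒜 : ℕ → Submodule ℤ A) [GradedAlgebra 𝒜] (i j : ℕ) : Type _ :=
  cocycles G 𝒜 i j ⧸ (coboundaries G 𝒜 i j).submoduleOf (cocycles G 𝒜 i j)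

/-! The facts below show that `d` is a degree-preserving differential. -/

theorem d_apply (i : ℕ) (c : Cochain G A i) (t : State G (i + 1)) :
    d G A i c t = ∑ e : {e // e ∈ t.1},
      sign t.1 e • edgeMap G A (s := ((t.erase e).1 : Set β))
        (Finset.coe_subset.2 (Finset.erase_subset _ _)) (c (t.erase e)) := by
  simp [d]

theorem sign_mul_sign {t : Finset β} {e f : β} (he : e ∈ t) (hf : f ∈ t) (hef : e ≠ f) :
    sign t e * sign (t.erase e) f + sign t f * sign (t.erase f) e = 0 := by
  wlog h : e < f generalizing e f
  · rw [add_comm]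
    exact this hf he hef.symm (lt_of_le_of_ne (not_lt.1 h) hef.symm)
  have h1 : (t.erase f).filter (· < e) = t.filter (· < e) := by
    ext x
    simp only [Finset.mem_filter, Finset.mem_erase]
    exact ⟨fun hx => ⟨hx.1.2, hx.2⟩, fun hx => ⟨⟨(hx.2.trans h).ne, hx.1⟩, hx.2⟩⟩
  have h2 : (t.filter (· < f)).card = ((t.erase e).filter (· < f)).card + 1 := by
    rw [Finset.filter_erase, Finset.card_erase_add_one (by simp [he, h])]
  simp only [sign, h1, h2]
  ring

theorem d_d (i : ℕ) (c : Cochain G A i) : d G A (i + 1) (d G A i c) = 0 := by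
  funext t
  simp only [d_apply, map_sum, map_smul, edgeMap_edgeMap, Finset.smul_sum, smul_smul,
    Pi.zero_apply]
  rw [Finset.sum_sigma']
  refine Finset.sum_involution
    (fun p _ => ⟨⟨p.2.1, Finset.mem_of_mem_erase p.2.2⟩, ⟨p.1.1,
      Finset.mem_erase.2 ⟨(Finset.ne_of_mem_erase p.2.2).symm, p.1.2⟩⟩⟩) ?_ ?_ ?_ ?_
  · rintro ⟨⟨e, he⟩, ⟨f, hf⟩⟩ -
    have hne : f ≠ e := Finset.ne_of_mem_erase hf
    have hft : f ∈ t.1 := Finset.mem_of_mem_erase hf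
    have hs : (t.erase ⟨e, he⟩).erase ⟨f, hf⟩ =
        (t.erase ⟨f, hft⟩).erase ⟨e, Finset.mem_erase.2 ⟨hne.symm, he⟩⟩ :=
      Subtype.ext (Finset.erase_right_comm)
    have hz := sign_mul_sign he hft hne.symm
    simp only
    rw [edgeMap_congr G c hs _ (((Finset.coe_subset.2 (Finset.erase_subset _ _)).trans
      (Finset.coe_subset.2 (Finset.erase_subset _ _)))), ← add_smul]
    exact (congrArg (· • _) hz).trans (zero_smul _ _)
  · rintro ⟨⟨e, he⟩, ⟨f, hf⟩⟩ - - h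
    have hne : f ≠ e := Finset.ne_of_mem_erase hf
    exact hne (congrArg (fun p => p.1.1) h)
  · intros
    exact Finset.mem_sigma.2 ⟨Finset.mem_univ _, Finset.mem_univ _⟩
  · intros
    rfl

theorem d_mem_cochainDegree (𝒜 : ℕ → Submodule ℤ A) [SetLike.GradedMonoid 𝒜] {i j : ℕ}
    {c : Cochain G A i} (hc : c ∈ cochainDegree G 𝒜 i j) :
    d G A i c ∈ cochainDegree G 𝒜 (i + 1) j := by
  intro t _
  rw [d_apply]
  exact Submodule.sum_mem _ fun e _ => Submodule.smul_mem _ _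
    (mergeMap_mem_tensorDegree 𝒜 _ (hc _ (Set.mem_univ _)))

theorem coboundaries_le_cocycles (𝒜 : ℕ → Submodule ℤ A) [SetLike.GradedMonoid 𝒜] (i j : ℕ) :
    coboundaries G 𝒜 i j ≤ cocycles G 𝒜 i j := by
  cases i with
  | zero => exact bot_le
  | succ i =>
    rintro _ ⟨c, hc, rfl⟩
    exact ⟨d_mem_cochainDegree G 𝒜 hc, d_d G i c⟩

end Complex

/-! ### The algebra `ℤ[x]/(x^m)` -/

/-- The algebra `A_m = ℤ[x]/(x^m)`. -/
abbrev TruncPoly (m : ℕ) : Type := ℤ[X] ⧸ Ideal.span {(Polynomial.X : ℤ[X]) ^ m}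

/-- The degree `j` part of `A_m`, spanned by the class of `x^j`. -/
def truncGrading (m : ℕ) (j : ℕ) : Submodule ℤ (TruncPoly m) :=
  Submodule.span ℤ {Ideal.Quotient.mk _ (Polynomial.X ^ j)}

instance (m : ℕ) : SetLike.GradedMonoid (truncGrading m) where
  one_mem := Submodule.subset_span (by simp)
  mul_mem := by
    intro i j a b ha hb
    obtain ⟨r, rfl⟩ := Submodule.mem_span_singleton.1 ha
    obtain ⟨r', rfl⟩ := Submodule.mem_span_singleton.1 hb
    refine Submodule.mem_span_singleton.2 ⟨r * r', ?_⟩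
    rw [pow_add, map_mul, smul_mul_smul_comm]

/-- The decomposition of an element of `A_m` into homogeneous components. -/
def truncDecompose (m : ℕ) :
    TruncPoly m →ₐ[ℤ] DirectSum ℕ fun j => truncGrading m j :=
  Ideal.Quotient.liftₐ _
    (Polynomial.aeval (DirectSum.of (fun j => truncGrading m j) 1
      ⟨Ideal.Quotient.mk _ (Polynomial.X ^ 1), Submodule.subset_span rfl⟩)) (by
    intro p hp
    obtain ⟨q, rfl⟩ := Ideal.mem_span_singleton.1 hp
    have h0 : (Ideal.Quotient.mk (Ideal.span {(Polynomial.X : ℤ[X]) ^ m})) Polynomial.X ^ m = 0 := by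
      rw [← map_pow]
      exact Ideal.Quotient.eq_zero_iff_mem.2 (Ideal.subset_span rfl)
    rw [map_mul, map_pow, Polynomial.aeval_X, DirectSum.ofPow]
    have h1 : GradedMonoid.GMonoid.gnpow (A := fun j => truncGrading m j) m
        ⟨Ideal.Quotient.mk _ (Polynomial.X ^ 1), Submodule.subset_span rfl⟩ = 0 := by
      apply Subtype.ext
      rw [SetLike.coe_gnpow]
      simpa using h0
    rw [h1, map_zero, zero_mul])

theorem truncDecompose_mk (m : ℕ) (p : ℤ[X]) :
    truncDecompose m (Ideal.Quotient.mk _ p) =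
      Polynomial.aeval (DirectSum.of (fun j => truncGrading m j) 1
        ⟨Ideal.Quotient.mk _ (Polynomial.X ^ 1), Submodule.subset_span rfl⟩) p :=
  rfl

instance (m : ℕ) : GradedAlgebra (truncGrading m) :=
  GradedAlgebra.ofAlgHom _ (truncDecompose m)
    (by
      apply Ideal.Quotient.algHom_ext
      ext
      simp only [AlgHom.coe_comp, Function.comp_apply, AlgHom.coe_id, id]
      erw [truncDecompose_mk]
      simp)
    (by
      rintro i ⟨x, hx⟩
      obtain ⟨r, rfl⟩ := Submodule.mem_span_singleton.1 hx
      change truncDecompose m (r • Ideal.Quotient.mk _ (Polynomial.X ^ i)) = _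
      rw [map_smul, truncDecompose_mk, map_pow, Polynomial.aeval_X, DirectSum.ofPow,
        ← DirectSum.of_smul]
      apply DirectSum.of_eq_of_gradedMonoid_eq
      refine Sigma.subtype_ext (mul_one i) ?_
      change r • ((Ideal.Quotient.mk _ (Polynomial.X ^ 1)) ^ i : TruncPoly m) = r • _
      rw [pow_one, map_pow])

end ChromaticCohomology

end

noncomputable section

namespace ChromaticCohomology

/-! ### Cube complexes on intervals of finite sets -/

section Cube

variable {β R : Type*} [DecidableEq β] [CommRing R] {M : Finset β → Type*}
  [∀ S, AddCommGroup (M S)] [∀ S, Module R (M S)]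

/-! The argument treats all minors of $G$ at once. For $T \subseteq U \subseteq E$, the part of the
cube between $T$ and $U$ is, up to a height shift by $|T|$ and signs, the chromatic complex of the
minor that contracts $T$ and deletes the edges outside $U$. Its vertices are the components of
$[G:T]$, its components those of $[G:U]$. Write $v$ and $\mu$ for their numbers, and $n_c$ for the
number of vertices in component $c$. By induction on $|U \setminus T|$, the cohomology at relative
height $i$ and degree $j$ vanishes unless $i \le \sum_c \max(n_c-2,0)$, $v-\mu \le i+j$ and
$(m-1)i+j \le (m-1)v$; it is torsion-free when $i+j \le v-\mu$ (`chromaticExact_of_not_inRange`).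

A loop makes the complex the cone of an isomorphism, so everything vanishes
(`cubeExact_of_bijective`). If an edge $e$ lies on a cycle, the long exact sequence of deletion and
contraction applies (`cubeExact_of_delete_of_contract`). Deletion keeps $v$, $\mu$ and the $n_c$;
contraction lowers $v$ by one and raises the height by one, which preserves the last two bounds. It
also preserves the first one if $n_c \ge 3$; if $n_c = 2$, contraction creates a loop
(`exists_loop_insert`).

If no edge lies on a cycle, the minor is a forest and has a leaf (`exists_leaf`). Adding a leaf edge
is a split surjection, whose kernel is a sum of copies of the complex of the contraction, with
degrees shifted by $k = 1, \dots, m-1$ (`cubeExact_of_pendant`). The bound $k \ge 1$ keeps the lower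
line and $k \le m-1$ the upper one. Without edges there is only a tensor power of a free module.

`CubeExact` covers vanishing and torsion together: $n = 0$ says that the cohomology is zero, $n \ne
0$ that it has no $n$-torsion. Heights are integers and count the contracted edges. For $T =
\emptyset$, in the absence of loops and isolated vertices, every $n_c \ge 2$, so the first bound
becomes $v-2\mu$. -/

/-- The differential of the cube complex of a family of modules indexed by finite sets, relative to
a set `T` of elements that are never removed. -/
def cubeD (sg : Finset β → β → R) (φ : ∀ S S', M S →ₗ[R] M S') (T : Finset β) :
    (∀ S, M S) →ₗ[R] (∀ S, M S) :=
  LinearMap.pi fun S => ∑ e ∈ S \ T, sg S e • φ (S.erase e) S ∘ₗ LinearMap.proj (S.erase e)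

/-- Signs on the edges of the cube for which each square anticommutes. -/
structure IsCubeSign (sg : Finset β → β → R) : Prop where
  mul_self : ∀ S e, sg S e * sg S e = 1
  anticomm : ∀ (S : Finset β) (e f : β), e ∈ S → f ∈ S → e ≠ f →
    sg S e * sg (S.erase e) f + sg S f * sg (S.erase f) e = 0

/-- The maps `φ` compose along inclusions. -/
def IsCubeFunctor (φ : ∀ S S', M S →ₗ[R] M S') : Prop :=
  ∀ (S S' S'' : Finset β), S ⊆ S' → S' ⊆ S'' → ∀ x, φ S' S'' (φ S S' x) = φ S S'' x

/-- The maps `φ` preserve the submodules `L` along inclusions. -/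
def IsCubeStable (φ : ∀ S S', M S →ₗ[R] M S') (L : ∀ S, Submodule R (M S)) : Prop :=
  ∀ (S S' : Finset β), S ⊆ S' → ∀ x ∈ L S, φ S S' x ∈ L S'

/-- Every class annihilated by `n` in the cohomology at height `I` of the subcomplex `L` of the
cube complex on the interval `[T, U]` vanishes. -/
def CubeExact (sg : Finset β → β → R) (φ : ∀ S S', M S →ₗ[R] M S') (L : ∀ S, Submodule R (M S))
    (T U : Finset β) (I : ℤ) (n : R) : Prop :=
  ∀ z w : ∀ S, M S, (∀ S, z S ∈ L S) → (∀ S, w S ∈ L S) →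
    (∀ S, T ⊆ S → S ⊆ U → (S.card : ℤ) = I + 1 → cubeD sg φ T z S = 0) →
    (∀ S, T ⊆ S → S ⊆ U → (S.card : ℤ) = I → n • z S = cubeD sg φ T w S) →
    ∃ u : ∀ S, M S, (∀ S, u S ∈ L S) ∧
      ∀ S, T ⊆ S → S ⊆ U → (S.card : ℤ) = I → z S = cubeD sg φ T u S

variable {sg : Finset β → β → R} {φ : ∀ S S', M S →ₗ[R] M S'} {L : ∀ S, Submodule R (M S)}
  {T U : Finset β} {I : ℤ} {n : R}

theorem cubeD_apply (c : ∀ S, M S) (S : Finset β) :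
    cubeD sg φ T c S = ∑ e ∈ S \ T, sg S e • φ (S.erase e) S (c (S.erase e)) := by
  simp [cubeD]

theorem cubeD_congr {c c' : ∀ S, M S} {S : Finset β}
    (h : ∀ e ∈ S, e ∉ T → c (S.erase e) = c' (S.erase e)) :
    cubeD sg φ T c S = cubeD sg φ T c' S := by
  rw [cubeD_apply, cubeD_apply]
  refine Finset.sum_congr rfl fun e he => ?_
  rw [Finset.mem_sdiff] at he
  rw [h e he.1 he.2]

theorem cubeD_eq_zero {c : ∀ S, M S} {S : Finset β}
    (h : ∀ e ∈ S, e ∉ T → c (S.erase e) = 0) : cubeD sg φ T c S = 0 := by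
  rw [cubeD_apply]
  refine Finset.sum_eq_zero fun e he => ?_
  rw [Finset.mem_sdiff] at he
  rw [h e he.1 he.2, map_zero, smul_zero]

theorem cubeD_mem (hL : IsCubeStable φ L) {c : ∀ S, M S} (hc : ∀ S, c S ∈ L S) (S : Finset β) :
    cubeD sg φ T c S ∈ L S := by
  rw [cubeD_apply]
  exact Submodule.sum_mem _ fun e _ =>
    Submodule.smul_mem _ _ (hL _ _ (Finset.erase_subset _ _) _ (hc _))

/-- The differential of the contraction, in which `e` is never removed, lacks exactly the term for
`e`. -/
theorem cubeD_insert {e : β} {S : Finset β} (he : e ∈ S) (heT : e ∉ T) (c : ∀ S, M S) :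
    cubeD sg φ T c S =
      sg S e • φ (S.erase e) S (c (S.erase e)) + cubeD sg φ (insert e T) c S := by
  rw [cubeD_apply, cubeD_apply, Finset.sdiff_insert,
    Finset.add_sum_erase _ (fun e => sg S e • φ (S.erase e) S (c (S.erase e)))
    (Finset.mem_sdiff.2 ⟨he, heT⟩)]

theorem cubeD_cubeD (hs : IsCubeSign sg) (hφ : IsCubeFunctor φ) (c : ∀ S, M S) :
    cubeD sg φ T (cubeD sg φ T c) = 0 := by
  funext S
  simp only [cubeD_apply, map_sum, map_smul, Finset.smul_sum, smul_smul, Pi.zero_apply]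
  rw [Finset.sum_sigma']
  refine Finset.sum_involution (fun p _ => ⟨p.2, p.1⟩) ?_ ?_ ?_ ?_
  · rintro ⟨e, f⟩ h
    simp only [Finset.mem_sigma, Finset.mem_sdiff, Finset.mem_erase] at h
    obtain ⟨⟨he, heT⟩, ⟨hne, hf⟩, hfT⟩ := h
    simp only
    rw [hφ _ _ _ (Finset.erase_subset _ _) (Finset.erase_subset _ _),
      hφ _ _ _ (Finset.erase_subset _ _) (Finset.erase_subset _ _),
      Finset.erase_right_comm, ← add_smul, hs.anticomm S e f he hf hne.symm, zero_smul]
  · rintro ⟨e, f⟩ h - h'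
    simp only [Finset.mem_sigma, Finset.mem_sdiff, Finset.mem_erase] at h
    exact h.2.1.1 (congrArg (fun p : Σ _ : β, β => p.1) h')
  · rintro ⟨e, f⟩ h
    simp only [Finset.mem_sigma, Finset.mem_sdiff, Finset.mem_erase] at h ⊢
    exact ⟨⟨h.2.1.2, h.2.2⟩, ⟨h.2.1.1.symm, h.1.1⟩, h.1.2⟩
  · intros
    rfl

theorem cubeExact_bot : CubeExact sg φ (fun _ => ⊥) T U I n := by
  intro z w hz _ _ _
  refine ⟨0, fun S => Submodule.zero_mem _, fun S _ _ _ => ?_⟩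
  rw [map_zero, Pi.zero_apply]
  exact (Submodule.mem_bot R).1 (hz S)

/-- The deletion-contraction long exact sequence. -/
theorem cubeExact_of_delete_of_contract (hs : IsCubeSign sg) (hφ : IsCubeFunctor φ)
    (hL : IsCubeStable φ L) {e : β} (heT : e ∉ T)
    (hc : CubeExact sg φ L (insert e T) U I n) (hd : CubeExact sg φ L T (U.erase e) I n)
    (h0 : n = 0 ∨ CubeExact sg φ L T (U.erase e) (I - 1) 0) :
    CubeExact sg φ L T U I n := by
  intro z w hz hw hdz hnz
  have hU : U.erase e ⊆ U := Finset.erase_subset _ _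
  obtain ⟨a', ha'L, ha'⟩ := hd z w hz hw (fun S h1 h2 h3 => hdz S h1 (h2.trans hU) h3)
    (fun S h1 h2 h3 => hnz S h1 (h2.trans hU) h3)
  -- The restriction of `z` to the deletion is a coboundary. Subtracting it leaves a cocycle
  -- supported on sets containing `e`, that is, a cocycle of the contraction.
  set z1 := z - cubeD sg φ T a' with hz1
  have hz1L : ∀ S, z1 S ∈ L S := fun S => Submodule.sub_mem _ (hz S) (cubeD_mem hL ha'L S)
  have hz10 : ∀ S, T ⊆ S → S ⊆ U → (S.card : ℤ) = I → e ∉ S → z1 S = 0 := fun S h1 h2 h3 h4 =>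
    sub_eq_zero.2 (ha' S h1 (Finset.subset_erase.2 ⟨h2, h4⟩) h3)
  have hdz1 : ∀ S, T ⊆ S → S ⊆ U → (S.card : ℤ) = I + 1 → cubeD sg φ T z1 S = 0 := by
    intro S h1 h2 h3
    rw [hz1, map_sub, cubeD_cubeD hs hφ, sub_zero]
    exact hdz S h1 h2 h3
  -- The witness for `n • z1` must also be supported on sets containing `e`. Its restriction to the
  -- deletion is a cocycle one height lower, because `z1` vanishes there; exactness at `I - 1`
  -- removes it. For `n = 0` the witness `0` serves.
  have hw1 : ∃ w1 : ∀ S, M S, (∀ S, w1 S ∈ L S) ∧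
      (∀ S, T ⊆ S → S ⊆ U → (S.card : ℤ) = I → n • z1 S = cubeD sg φ T w1 S) ∧
      (∀ S, T ⊆ S → S ⊆ U → (S.card : ℤ) = I - 1 → e ∉ S → w1 S = 0) := by
    rcases h0 with rfl | h0
    · refine ⟨0, fun S => Submodule.zero_mem _, fun S _ _ _ => ?_, fun S _ _ _ _ => rfl⟩
      rw [zero_smul, map_zero, Pi.zero_apply]
    have hn1 : ∀ S, T ⊆ S → S ⊆ U → (S.card : ℤ) = I →
        n • z1 S = cubeD sg φ T (w - n • a') S := by
      intro S h1 h2 h3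
      rw [hz1, map_sub, map_smul, Pi.sub_apply, Pi.sub_apply, smul_sub, hnz S h1 h2 h3,
        Pi.smul_apply]
    have hwL : ∀ S, (w - n • a') S ∈ L S := fun S =>
      Submodule.sub_mem _ (hw S) (Submodule.smul_mem _ _ (ha'L S))
    obtain ⟨w', hw'L, hw'⟩ := h0 (w - n • a') 0 hwL (fun S => Submodule.zero_mem _) (by
      intro S h1 h2 h3
      have h4 := Finset.subset_erase.1 h2
      rw [← hn1 S h1 h4.1 (by omega), hz10 S h1 h4.1 (by omega) h4.2, smul_zero]) (by
      intro S _ _ _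
      rw [zero_smul, map_zero, Pi.zero_apply])
    refine ⟨(w - n • a') - cubeD sg φ T w',
      fun S => Submodule.sub_mem _ (hwL S) (cubeD_mem hL hw'L S), ?_, ?_⟩
    · intro S h1 h2 h3
      rw [map_sub (cubeD sg φ T), cubeD_cubeD hs hφ, sub_zero]
      exact hn1 S h1 h2 h3
    · intro S h1 h2 h3 h4
      exact sub_eq_zero.2 (hw' S h1 (Finset.subset_erase.2 ⟨h2, h4⟩) h3)
  obtain ⟨w1, hw1L, hnz1, hw10⟩ := hw1
  obtain ⟨b, hbL, hb⟩ := hc z1 w1 hz1L hw1L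
    (by
      intro S h1 h2 h3
      obtain ⟨h4, h5⟩ := Finset.insert_subset_iff.1 h1
      have h6 := hdz1 S h5 h2 h3
      have h7 := Finset.card_erase_add_one h4
      rwa [cubeD_insert h4 heT, hz10 _ (Finset.subset_erase.2 ⟨h5, heT⟩)
        ((Finset.erase_subset _ _).trans h2) (by omega) (Finset.notMem_erase _ _), map_zero,
        smul_zero, zero_add] at h6)
    (by
      intro S h1 h2 h3
      obtain ⟨h4, h5⟩ := Finset.insert_subset_iff.1 h1
      have h7 := Finset.card_erase_add_one h4
      rw [hnz1 S h5 h2 h3, cubeD_insert h4 heT, hw10 _ (Finset.subset_erase.2 ⟨h5, heT⟩)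
        ((Finset.erase_subset _ _).trans h2) (by omega) (Finset.notMem_erase _ _), map_zero,
        smul_zero, zero_add])
  -- The contraction is a subcomplex, so its cochains are extended by zero.
  let b' : ∀ S, M S := fun S => if e ∈ S then b S else 0
  refine ⟨a' + b', ?_, ?_⟩
  · intro S
    refine Submodule.add_mem _ (ha'L S) ?_
    by_cases h : e ∈ S
    · simpa [b', h] using hbL S
    · simp [b', h]
  · intro S h1 h2 h3
    suffices h : z1 S = cubeD sg φ T b' S by
      rw [map_add, Pi.add_apply, ← h, hz1, Pi.sub_apply]
      abel
    by_cases heS : e ∈ S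
    · rw [hb S (Finset.insert_subset heS h1) h2 h3, cubeD_insert heS heT]
      have : b' (S.erase e) = 0 := by simp [b']
      rw [this, map_zero, smul_zero, zero_add]
      refine cubeD_congr fun f _ hf => ?_
      have : e ∈ S.erase f :=
        Finset.mem_erase.2 ⟨fun h => hf (h ▸ Finset.mem_insert_self _ _), heS⟩
      simp [b', this]
    · rw [hz10 S h1 h2 h3 heS, cubeD_eq_zero]
      intro f _ _
      have : e ∉ S.erase f := fun h => heS (Finset.mem_of_mem_erase h)
      simp [b', this]

/-- The anticommutation of signs, in terms of a set not containing `e`. -/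
theorem IsCubeSign.insert_anticomm (hs : IsCubeSign sg) {S : Finset β} {e f : β} (he : e ∉ S)
    (hf : f ∈ S) :
    sg S f * sg (insert e (S.erase f)) e = -(sg (insert e S) e * sg (insert e S) f) := by
  have hne : e ≠ f := fun h => he (h ▸ hf)
  have h := hs.anticomm (insert e S) e f (Finset.mem_insert_self _ _) (Finset.mem_insert_of_mem hf)
    hne
  rw [Finset.erase_insert he, Finset.erase_insert_of_ne hne] at h
  have h1 := hs.mul_self (insert e S) e
  have h2 := hs.mul_self (insert e (S.erase f)) e
  linear_combination (sg (insert e S) e * sg (insert e (S.erase f)) e) * h -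
    sg S f * sg (insert e (S.erase f)) e * h1 - sg (insert e S) e * sg (insert e S) f * h2

/-- Extension of a cochain on sets containing `e` to the sets not containing `e`. -/
def cubeLower (sg : Finset β → β → R) (e : β) (θ : ∀ S S', M S' →ₗ[R] M S) (c : ∀ S, M S) :
    ∀ S, M S :=
  fun S => if e ∈ S then 0 else sg (insert e S) e • θ S (insert e S) (c (insert e S))

theorem cubeLower_of_mem (θ : ∀ S S', M S' →ₗ[R] M S) (c : ∀ S, M S) {e : β} {S : Finset β}
    (h : e ∈ S) : cubeLower sg e θ c S = 0 := by
  simp [cubeLower, h]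

theorem cubeLower_of_notMem (θ : ∀ S S', M S' →ₗ[R] M S) (c : ∀ S, M S) {e : β} {S : Finset β}
    (h : e ∉ S) : cubeLower sg e θ c S =
      sg (insert e S) e • θ S (insert e S) (c (insert e S)) := by
  simp [cubeLower, h]

theorem cubeLower_mem {L' : ∀ S, Submodule R (M S)} {θ : ∀ S S', M S' →ₗ[R] M S}
    (hθ : ∀ S S', ∀ x ∈ L' S', θ S S' x ∈ L S) {c : ∀ S, M S} (hc : ∀ S, c S ∈ L' S) (e : β)
    (S : Finset β) : cubeLower sg e θ c S ∈ L S := by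
  by_cases h : e ∈ S
  · simp [cubeLower, h]
  · simpa [cubeLower, h] using Submodule.smul_mem _ _ (hθ _ _ _ (hc _))

/-- `θ` commutes with the maps `φ` on the sets of the interval not containing `e`. -/
def LowerNatural (φ : ∀ S S', M S →ₗ[R] M S') (e : β) (T U : Finset β)
    (θ : ∀ S S', M S' →ₗ[R] M S) : Prop :=
  ∀ S S', T ⊆ S → S ⊆ S' → S' ⊆ U → e ∉ S' → ∀ x,
    φ S S' (θ S (insert e S) x) = θ S' (insert e S') (φ (insert e S) (insert e S') x)

/-- `ρ` commutes with the maps `φ` on the sets of the interval not containing `e`. -/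
def UpperNatural (φ : ∀ S S', M S →ₗ[R] M S') (e : β) (T U : Finset β)
    (ρ : ∀ S S', M S →ₗ[R] M S') : Prop :=
  ∀ S S', T ⊆ S → S ⊆ S' → S' ⊆ U → e ∉ S' → ∀ x,
    ρ S' (insert e S') (φ S S' x) = φ (insert e S) (insert e S') (ρ S (insert e S) x)

/-- The sign built into `cubeLower` turns anticommuting squares into an overall minus sign: lowering
anticommutes with the differentials wherever `θ` is natural. -/
theorem cubeD_cubeLower_of_notMem (hs : IsCubeSign sg) {e : β} {θ : ∀ S S', M S' →ₗ[R] M S}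
    (hθ : LowerNatural φ e T U θ) (c : ∀ S, M S) {S : Finset β} (hTS : T ⊆ S) (hSU : S ⊆ U)
    (heS : e ∉ S) :
    cubeD sg φ T (cubeLower sg e θ c) S =
      -(sg (insert e S) e • θ S (insert e S) (cubeD sg φ (insert e T) c (insert e S))) := by
  have hst : insert e S \ insert e T = S \ T := by
    ext f
    simp only [Finset.mem_sdiff, Finset.mem_insert, not_or]
    constructor
    · rintro ⟨h1 | h1, h2, h3⟩
      · exact absurd h1 h2
      · exact ⟨h1, h3⟩
    · rintro ⟨h1, h2⟩
      exact ⟨Or.inr h1, fun h => heS (h ▸ h1), h2⟩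
  rw [cubeD_apply, cubeD_apply, hst, map_sum, Finset.smul_sum, ← Finset.sum_neg_distrib]
  refine Finset.sum_congr rfl fun f hf => ?_
  obtain ⟨hf1, hf2⟩ := Finset.mem_sdiff.1 hf
  have hne : e ≠ f := fun h => heS (h ▸ hf1)
  rw [cubeLower_of_notMem _ _ (fun h => heS (Finset.mem_of_mem_erase h)), map_smul,
    hθ (S.erase f) S (Finset.subset_erase.2 ⟨hTS, hf2⟩) (Finset.erase_subset _ _) hSU heS,
    smul_smul, hs.insert_anticomm heS hf1, Finset.erase_insert_of_ne hne, map_smul, smul_smul,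
    neg_smul]

theorem cubeD_cubeLower_of_mem {e : β} {θ : ∀ S S', M S' →ₗ[R] M S} (c : ∀ S, M S)
    {S : Finset β} (heT : e ∉ T) (heS : e ∈ S) (hs : IsCubeSign sg) :
    cubeD sg φ T (cubeLower sg e θ c) S = φ (S.erase e) S (θ (S.erase e) S (c S)) := by
  rw [cubeD_insert heS heT, cubeLower_of_notMem _ _ (Finset.notMem_erase _ _),
    Finset.insert_erase heS, map_smul, smul_smul, hs.mul_self, one_smul, cubeD_eq_zero, add_zero]
  intro f hf hfT
  exact cubeLower_of_mem _ _
    (Finset.mem_erase.2 ⟨fun h => hfT (h ▸ Finset.mem_insert_self _ _), heS⟩)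

/-- Exactness when source and target of each map of the cube that adds `e` are isomorphic. -/
theorem cubeExact_of_bijective (hs : IsCubeSign sg) (hφ : IsCubeFunctor φ)
    {e : β} (heT : e ∉ T) (heU : e ∈ U)
    (ψ : ∀ S S', M S' →ₗ[R] M S) (hψL : ∀ S S', ∀ x ∈ L S', ψ S S' x ∈ L S)
    (hψφ : ∀ S, T ⊆ S → e ∉ S → ∀ x, ψ S (insert e S) (φ S (insert e S) x) = x)
    (hφψ : ∀ S, T ⊆ S → e ∉ S → ∀ x, φ S (insert e S) (ψ S (insert e S) x) = x) :
    CubeExact sg φ L T U I n := by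
  intro z w hz _ hdz _
  -- Contracting homotopy: `b` inverts the maps that add `e`, so `z` minus the differential of `b`
  -- vanishes on sets containing `e`.
  set b := cubeLower sg e ψ z with hb
  have hbL : ∀ S, b S ∈ L S := cubeLower_mem hψL hz e
  have hdb : ∀ S, T ⊆ S → e ∈ S → cubeD sg φ T b S = z S := by
    intro S hTS heS
    have h := hφψ (S.erase e) (Finset.subset_erase.2 ⟨hTS, heT⟩) (Finset.notMem_erase e S)
    rw [Finset.insert_erase heS] at h
    rw [hb, cubeD_cubeLower_of_mem _ heT heS hs, h]
  refine ⟨b, hbL, fun S hTS hSU hI => ?_⟩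
  by_cases heS : e ∈ S
  · exact (hdb S hTS heS).symm
  · have hT' : T ⊆ insert e S := hTS.trans (Finset.subset_insert _ _)
    -- On `insert e S`, the differential of the corrected cocycle has only the term that adds `e`,
    -- and the corresponding map is injective.
    have h1 : cubeD sg φ T (z - cubeD sg φ T b) (insert e S) = 0 := by
      rw [map_sub, cubeD_cubeD hs hφ, sub_zero]
      refine hdz _ hT' (Finset.insert_subset heU hSU) ?_
      rw [Finset.card_insert_of_notMem heS]
      push_cast
      omega
    rw [cubeD_insert (Finset.mem_insert_self e S) heT, Finset.erase_insert heS,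
      cubeD_eq_zero (c := z - cubeD sg φ T b), add_zero] at h1
    · have h2 : φ S (insert e S) ((z - cubeD sg φ T b) S) = 0 := by
        rw [← one_smul R (φ S (insert e S) _), ← hs.mul_self (insert e S) e, mul_smul, h1, smul_zero]
      have h3 := hψφ S hTS heS ((z - cubeD sg φ T b) S)
      rw [h2, map_zero] at h3
      exact sub_eq_zero.1 h3.symm
    · intro f hf hfT
      rw [Finset.mem_insert, not_or] at hfT
      rw [Pi.sub_apply, hdb, sub_self]
      · exact Finset.subset_erase.2 ⟨hT', hfT.2⟩
      · exact Finset.mem_erase.2 ⟨fun h => hfT.1 h.symm, Finset.mem_insert_self _ _⟩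

/-- The cochain on sets containing `e` obtained from one on sets not containing `e`. -/
def cubeUpper (sg : Finset β → β → R) (e : β) (ρ : ∀ S S', M S →ₗ[R] M S') (c : ∀ S, M S) :
    ∀ S, M S :=
  fun S => sg S e • ρ (S.erase e) S (c (S.erase e))

theorem cubeD_cubeUpper (hs : IsCubeSign sg) {e : β} {ρ : ∀ S S', M S →ₗ[R] M S'}
    (hρ : UpperNatural φ e T U ρ) (c : ∀ S, M S) {S : Finset β} (hTS : T ⊆ S) (hSU : S ⊆ U)
    (heS : e ∉ S) :
    cubeD sg φ (insert e T) (cubeUpper sg e ρ c) (insert e S) =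
      -cubeUpper sg e ρ (cubeD sg φ T c) (insert e S) := by
  have hst : insert e S \ insert e T = S \ T := by
    ext f
    simp only [Finset.mem_sdiff, Finset.mem_insert, not_or]
    constructor
    · rintro ⟨h1 | h1, h2, h3⟩
      · exact absurd h1 h2
      · exact ⟨h1, h3⟩
    · rintro ⟨h1, h2⟩
      exact ⟨Or.inr h1, fun h => heS (h ▸ h1), h2⟩
  rw [cubeUpper, cubeD_apply, Finset.erase_insert heS, cubeD_apply, hst, map_sum, Finset.smul_sum,
    ← Finset.sum_neg_distrib]
  refine Finset.sum_congr rfl fun f hf => ?_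
  obtain ⟨hf1, hf2⟩ := Finset.mem_sdiff.1 hf
  have hne : e ≠ f := fun h => heS (h ▸ hf1)
  have heSf : e ∉ S.erase f := fun h => heS (Finset.mem_of_mem_erase h)
  rw [Finset.erase_insert_of_ne hne, cubeUpper, Finset.erase_insert heSf, map_smul, map_smul,
    hρ (S.erase f) S (Finset.subset_erase.2 ⟨hTS, hf2⟩) (Finset.erase_subset _ _) hSU heS,
    smul_smul, smul_smul, ← neg_smul]
  congr 1
  have h := hs.insert_anticomm heS hf1
  have h1 := hs.mul_self (insert e S) e
  have h2 := hs.mul_self (insert e (S.erase f)) e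
  linear_combination (sg (insert e S) e * sg (insert e (S.erase f)) e) * h
    - sg (insert e S) f * sg (insert e (S.erase f)) e * h1 - sg (insert e S) e * sg S f * h2

/-- Exactness for a pendant edge `e`: the kernel of the split surjection that adds `e` decomposes
into copies `θ k` of the complex in which `e` is contracted. -/
theorem cubeExact_of_pendant (hs : IsCubeSign sg) (hφ : IsCubeFunctor φ) (hL : IsCubeStable φ L)
    {e : β} (heT : e ∉ T) (heU : e ∈ U) {K : Type*} [Fintype K]
    {L' : K → ∀ S, Submodule R (M S)}
    {ι : ∀ S S', M S' →ₗ[R] M S} {θ : K → ∀ S S', M S' →ₗ[R] M S} {ρ : K → ∀ S S', M S →ₗ[R] M S'}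
    (hιL : ∀ S S', ∀ x ∈ L S', ι S S' x ∈ L S)
    (hθL : ∀ k S S', ∀ x ∈ L' k S', θ k S S' x ∈ L S)
    (hρL : ∀ k S S', ∀ x ∈ L S, ρ k S S' x ∈ L' k S')
    (hι : ∀ S, T ⊆ S → S ⊆ U → e ∉ S → ∀ x, φ S (insert e S) (ι S (insert e S) x) = x)
    (hφθ : ∀ k S, T ⊆ S → S ⊆ U → e ∉ S → ∀ x, φ S (insert e S) (θ k S (insert e S) x) = 0)
    (hsum : ∀ S, T ⊆ S → S ⊆ U → e ∉ S → ∀ x, φ S (insert e S) x = 0 →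
      x = ∑ k, θ k S (insert e S) (ρ k S (insert e S) x))
    (hθ : ∀ k, LowerNatural φ e T U (θ k)) (hρ : ∀ k, UpperNatural φ e T U (ρ k))
    (hE : ∀ k, CubeExact sg φ (L' k) (insert e T) U (I + 1) n) :
    CubeExact sg φ L T U I n := by
  intro z w hz hw hdz hnz
  -- The section `ι` of the surjection allows `z` to be modified by a coboundary so that it vanishes
  -- on sets containing `e`. The remaining values then lie in the kernel of adding `e`.
  set b := cubeLower sg e ι z with hb
  have hbL : ∀ S, b S ∈ L S := cubeLower_mem hιL hz e
  have hdb : ∀ S, T ⊆ S → S ⊆ U → e ∈ S → cubeD sg φ T b S = z S := by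
    intro S h1 h2 h3
    have h := hι (S.erase e) (Finset.subset_erase.2 ⟨h1, heT⟩)
      ((Finset.erase_subset _ _).trans h2) (Finset.notMem_erase _ _)
    rw [Finset.insert_erase h3] at h
    rw [hb, cubeD_cubeLower_of_mem _ heT h3 hs, h]
  set z1 := z - cubeD sg φ T b with hz1
  set w1 := w - n • b with hw1
  have hz1L : ∀ S, z1 S ∈ L S := fun S => Submodule.sub_mem _ (hz S) (cubeD_mem hL hbL S)
  have hw1L : ∀ S, w1 S ∈ L S := fun S =>
    Submodule.sub_mem _ (hw S) (Submodule.smul_mem _ _ (hbL S))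
  have hz10 : ∀ S, T ⊆ S → S ⊆ U → e ∈ S → z1 S = 0 := fun S h1 h2 h3 =>
    sub_eq_zero.2 (hdb S h1 h2 h3).symm
  have hdz1 : ∀ S, T ⊆ S → S ⊆ U → (S.card : ℤ) = I + 1 → cubeD sg φ T z1 S = 0 := by
    intro S h1 h2 h3
    rw [hz1, map_sub, cubeD_cubeD hs hφ, sub_zero]
    exact hdz S h1 h2 h3
  have hnz1 : ∀ S, T ⊆ S → S ⊆ U → (S.card : ℤ) = I → n • z1 S = cubeD sg φ T w1 S := by
    intro S h1 h2 h3
    rw [hz1, hw1, map_sub, map_smul, Pi.sub_apply, Pi.sub_apply, smul_sub, hnz S h1 h2 h3,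
      Pi.smul_apply]
  have hUp : ∀ k (c : ∀ S, M S), (∀ S, c S ∈ L S) → ∀ S, cubeUpper sg e (ρ k) c S ∈ L' k S :=
    fun k c hc S => Submodule.smul_mem _ _ (hρL _ _ _ _ (hc _))
  have hsplit : ∀ S, insert e T ⊆ S → S ⊆ U →
      ∃ S0, S = insert e S0 ∧ T ⊆ S0 ∧ S0 ⊆ U ∧ e ∉ S0 ∧ S.card = S0.card + 1 := by
    intro S h1 h2
    obtain ⟨h4, h5⟩ := Finset.insert_subset_iff.1 h1
    exact ⟨S.erase e, (Finset.insert_erase h4).symm, Finset.subset_erase.2 ⟨h5, heT⟩,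
      (Finset.erase_subset _ _).trans h2, Finset.notMem_erase _ _,
      (Finset.card_erase_add_one h4).symm⟩
  -- Each coordinate `ρ k` turns `z1` into a cocycle of the contraction. The height is `I + 1` since
  -- `e` now belongs to the sets. The witness changes sign because raising anticommutes with the
  -- differentials.
  have hex : ∀ k, ∃ u : ∀ S, M S, (∀ S, u S ∈ L' k S) ∧ ∀ S, insert e T ⊆ S → S ⊆ U →
      (S.card : ℤ) = I + 1 → cubeUpper sg e (ρ k) z1 S = cubeD sg φ (insert e T) u S := by
    intro k
    refine hE k _ (-cubeUpper sg e (ρ k) w1) (hUp k z1 hz1L)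
      (fun S => Submodule.neg_mem _ (hUp k w1 hw1L S)) ?_ ?_
    · intro S h1 h2 h3
      obtain ⟨S0, rfl, h4, h5, h6, h7⟩ := hsplit S h1 h2
      rw [cubeD_cubeUpper hs (hρ k) _ h4 h5 h6, cubeUpper, Finset.erase_insert h6,
        hdz1 S0 h4 h5 (by omega), map_zero, smul_zero, neg_zero]
    · intro S h1 h2 h3
      obtain ⟨S0, rfl, h4, h5, h6, h7⟩ := hsplit S h1 h2
      rw [map_neg, Pi.neg_apply, cubeD_cubeUpper hs (hρ k) _ h4 h5 h6, neg_neg, cubeUpper,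
        cubeUpper, Finset.erase_insert h6, ← hnz1 S0 h4 h5 (by omega), map_smul, smul_comm]
  choose u huL hu using hex
  refine ⟨b - ∑ k, cubeLower sg e (θ k) (u k), ?_, ?_⟩
  · intro S
    refine Submodule.sub_mem _ (hbL S) ?_
    rw [Finset.sum_apply]
    exact Submodule.sum_mem _ fun k _ => cubeLower_mem (hθL k) (huL k) e S
  · intro S h1 h2 h3
    suffices h : z1 S = -∑ k, cubeD sg φ T (cubeLower sg e (θ k) (u k)) S by
      rw [map_sub, Pi.sub_apply, map_sum, Finset.sum_apply, sub_eq_add_neg, ← h, hz1, Pi.sub_apply]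
      abel
    by_cases heS : e ∈ S
    · rw [hz10 S h1 h2 heS, Finset.sum_eq_zero, neg_zero]
      intro k _
      have h := hφθ k (S.erase e) (Finset.subset_erase.2 ⟨h1, heT⟩)
        ((Finset.erase_subset _ _).trans h2) (Finset.notMem_erase _ _)
      rw [Finset.insert_erase heS] at h
      rw [cubeD_cubeLower_of_mem _ heT heS hs, h]
    · have hTe : insert e T ⊆ insert e S := Finset.insert_subset_insert _ h1
      have hSU : insert e S ⊆ U := Finset.insert_subset heU h2
      have hcard : ((insert e S).card : ℤ) = I + 1 := by
        rw [Finset.card_insert_of_notMem heS]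
        push_cast
        omega
      have h0 : φ S (insert e S) (z1 S) = 0 := by
        have h4 := hdz1 (insert e S) (h1.trans (Finset.subset_insert _ _)) hSU hcard
        rw [cubeD_insert (Finset.mem_insert_self e S) heT, Finset.erase_insert heS,
          cubeD_eq_zero (c := z1), add_zero] at h4
        · rw [← one_smul R (φ S (insert e S) _), ← hs.mul_self (insert e S) e, mul_smul, h4,
            smul_zero]
        · intro f hf hfT
          rw [Finset.mem_insert, not_or] at hfT
          refine hz10 _ (Finset.subset_erase.2 ⟨h1.trans (Finset.subset_insert _ _), hfT.2⟩)
            ((Finset.erase_subset _ _).trans hSU)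
            (Finset.mem_erase.2 ⟨fun h => hfT.1 h.symm, Finset.mem_insert_self _ _⟩)
      rw [← Finset.sum_neg_distrib]
      refine (hsum S h1 h2 heS _ h0).trans (Finset.sum_congr rfl fun k _ => ?_)
      rw [cubeD_cubeLower_of_notMem hs (hθ k) _ h1 h2 heS, neg_neg, ← hu k _ hTe hSU hcard,
        cubeUpper, Finset.erase_insert heS, map_smul, smul_smul, hs.mul_self, one_smul]

end Cube

/-! ### Operations on tensor powers -/

section TensorOperations

variable {A : Type*} [CommRing A] {ι κ : Type*} [Fintype ι] [DecidableEq ι] [DecidableEq κ]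

omit [DecidableEq ι] in
theorem mergeMap_mul (f : ι → κ) (y z : ⨂[ℤ] _ : ι, A) :
    mergeMap A f (y * z) = mergeMap A f y * mergeMap A f z := by
  induction y using PiTensorProduct.induction_on with
  | smul_tprod r a =>
    induction z using PiTensorProduct.induction_on with
    | smul_tprod s b =>
      rw [map_smul, map_smul, mergeMap_tprod, mergeMap_tprod,
        PiTensorProduct.smul_tprod_mul_smul_tprod, PiTensorProduct.smul_tprod_mul_smul_tprod,
        map_smul, mergeMap_tprod]
      congr 2
      funext k
      simp [Finset.prod_mul_distrib]
    | add z z' h h' => rw [mul_add, map_add, map_add, mul_add, h, h']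
  | add y y' h h' => rw [add_mul, map_add, map_add, add_mul, h, h']

variable (A) in
theorem mergeMap_id (z : ⨂[ℤ] _ : ι, A) : mergeMap A (id : ι → ι) z = z := by
  induction z using PiTensorProduct.induction_on with
  | smul_tprod r a =>
    rw [map_smul, mergeMap_tprod]
    congr 2
    funext k
    rw [Finset.prod_eq_single k] <;> simp +contextual
  | add y z hy hz => rw [map_add, hy, hz]

/-- The tensor `1 ⊗ ⋯ ⊗ a ⊗ ⋯ ⊗ 1` with `a` at `p`. -/
def singleTensor (p : ι) (a : A) : ⨂[ℤ] _ : ι, A :=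
  PiTensorProduct.tprod ℤ (Pi.mulSingle p a : ι → A)

omit [Fintype ι] in
theorem singleTensor_one (p : ι) : singleTensor p (1 : A) = 1 := by
  rw [singleTensor, Pi.mulSingle_one, PiTensorProduct.one_def]

theorem mergeMap_singleTensor (f : ι → κ) (p : ι) (a : A) [Fintype κ] :
    mergeMap A f (singleTensor p a) = singleTensor (f p) a := by
  rw [singleTensor, mergeMap_tprod, singleTensor]
  congr 1
  funext k
  by_cases hk : k = f p
  · subst hk
    rw [Pi.mulSingle_eq_same, Finset.prod_eq_single p]
    · simp
    · intro c _ hc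
      simp [Pi.mulSingle_eq_of_ne hc]
    · simp
  · rw [Pi.mulSingle_eq_of_ne hk, Finset.prod_eq_one]
    intro c hc
    refine Pi.mulSingle_eq_of_ne ?_ _
    rintro rfl
    exact hk (Finset.mem_filter.1 hc).2.symm

/-- Replacement of the tensor factor `a` at `p` by the scalar `c a`. -/
def evalAt (c : A →ₗ[ℤ] ℤ) (p : ι) : (⨂[ℤ] _ : ι, A) →ₗ[ℤ] ⨂[ℤ] _ : ι, A :=
  PiTensorProduct.map fun i => if i = p then (LinearMap.toSpanSingleton ℤ A 1) ∘ₗ c else LinearMap.id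

omit [Fintype ι] in
theorem evalAt_tprod (c : A →ₗ[ℤ] ℤ) (p : ι) (a : ι → A) :
    evalAt c p (PiTensorProduct.tprod ℤ a) =
      c (a p) • PiTensorProduct.tprod ℤ (Function.update a p 1) := by
  rw [evalAt, PiTensorProduct.map_tprod, ← MultilinearMap.map_update_smul]
  congr 1
  funext i
  by_cases h : i = p
  · subst h
    simp
  · simp [h]

/-- Nothing else is multiplied into the factor at `p`, so its coefficient can be extracted before or
after merging. -/
theorem evalAt_mergeMap [Fintype κ] (c : A →ₗ[ℤ] ℤ) (f : ι → κ) (p : ι)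
    (hp : ∀ i, f i = f p → i = p) (z : ⨂[ℤ] _ : ι, A) :
    evalAt c (f p) (mergeMap A f z) = mergeMap A f (evalAt c p z) := by
  have hfil : (Finset.univ.filter fun i => f i = f p) = {p} := by
    ext i
    simpa using ⟨hp i, fun h => h ▸ rfl⟩
  induction z using PiTensorProduct.induction_on with
  | smul_tprod r a =>
    simp only [map_smul, mergeMap_tprod, evalAt_tprod, fiberProd_update, hfil]
    simp
  | add y z hy hz => simp only [map_add, hy, hz]

/-- After evaluation the factor at `p` is `1`; moving it onto another factor changes nothing, and
the vacated slot receives an empty product. This is applied to adding a leaf edge followed by its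
section. -/
theorem mergeMap_evalAt (c : A →ₗ[ℤ] ℤ) (τ : ι → ι) (p : ι) (hp : τ p ≠ p)
    (hτ : ∀ i, i ≠ p → τ i = i) (z : ⨂[ℤ] _ : ι, A) :
    mergeMap A τ (evalAt c p z) = evalAt c p z := by
  induction z using PiTensorProduct.induction_on with
  | smul_tprod r a =>
    simp only [map_smul, mergeMap_tprod, evalAt_tprod]
    congr 3
    funext k
    by_cases hk : k = p
    · subst hk
      rw [Function.update_self, Finset.prod_eq_one]
      intro i hi
      have hi := (Finset.mem_filter.1 hi).2
      by_cases h : i = k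
      · exact absurd (h ▸ hi) hp
      · exact absurd ((hτ i h).symm.trans hi) h
    · rw [Finset.prod_eq_single k]
      · intro i hi hik
        have hi := (Finset.mem_filter.1 hi).2
        by_cases h : i = p
        · rw [h, Function.update_self]
        · exact absurd ((hτ i h).symm.trans hi) hik
      · intro h
        exact absurd (hτ k hk) (by simpa using h)
  | add y z hy hz => simp only [map_add, hy, hz]

omit [Fintype ι] in
theorem eq_sum_singleTensor_mul_evalAt {K : Type*} (s : Finset K) (c : K → A →ₗ[ℤ] ℤ) (x : K → A)
    (h : ∀ a, ∑ k ∈ s, c k a • x k = a) (p : ι) (z : ⨂[ℤ] _ : ι, A) :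
    z = ∑ k ∈ s, singleTensor p (x k) * evalAt (c k) p z := by
  induction z using PiTensorProduct.induction_on with
  | smul_tprod r a =>
    have h1 : ∀ k, singleTensor p (x k) * evalAt (c k) p (PiTensorProduct.tprod ℤ a) =
        PiTensorProduct.tprod ℤ (Function.update a p (c k (a p) • x k)) := by
      intro k
      rw [evalAt_tprod, mul_smul_comm, singleTensor, PiTensorProduct.tprod_mul_tprod,
        MultilinearMap.map_update_smul]
      congr 2
      funext i
      by_cases hi : i = p
      · subst hi
        simp
      · simp [hi]
    simp only [map_smul, mul_smul_comm, h1]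
    rw [← Finset.smul_sum, ← MultilinearMap.map_update_sum, h, Function.update_eq_self]
  | add y z hy hz => simp only [map_add, mul_add, Finset.sum_add_distrib, ← hy, ← hz]

omit [DecidableEq ι] in
theorem mul_mem_tensorDegree (𝒜 : ℕ → Submodule ℤ A) [SetLike.GradedMonoid 𝒜] {j k l : ℕ}
    (hjk : j + k = l) {y z : ⨂[ℤ] _ : ι, A} (hy : y ∈ tensorDegree 𝒜 ι j)
    (hz : z ∈ tensorDegree 𝒜 ι k) : y * z ∈ tensorDegree 𝒜 ι l := by
  induction hy using Submodule.span_induction with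
  | mem y hy =>
    obtain ⟨d, a, ha, hd, rfl⟩ := hy
    induction hz using Submodule.span_induction with
    | mem z hz =>
      obtain ⟨d', a', ha', hd', rfl⟩ := hz
      rw [PiTensorProduct.tprod_mul_tprod]
      refine Submodule.subset_span ⟨d + d', a * a', fun c => SetLike.mul_mem_graded (ha c) (ha' c),
        ?_, rfl⟩
      simp [Finset.sum_add_distrib, hd, hd', hjk]
    | zero => simp
    | add x y _ _ hx hy => rw [mul_add]; exact Submodule.add_mem _ hx hy
    | smul r x _ hx => rw [mul_smul_comm]; exact Submodule.smul_mem _ r hx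
  | zero => simp
  | add x y _ _ hx hy => rw [add_mul]; exact Submodule.add_mem _ hx hy
  | smul r x _ hx => rw [smul_mul_assoc]; exact Submodule.smul_mem _ r hx

theorem singleTensor_mem (𝒜 : ℕ → Submodule ℤ A) [SetLike.GradedMonoid 𝒜] {k : ℕ} {a : A}
    (ha : a ∈ 𝒜 k) (p : ι) : singleTensor p a ∈ tensorDegree 𝒜 ι k := by
  refine Submodule.subset_span ⟨Pi.single p k, _, fun i => ?_, by simp, rfl⟩
  by_cases h : i = p
  · subst h
    simpa using ha
  · rw [Pi.mulSingle_eq_of_ne h, Pi.single_eq_of_ne h]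
    exact SetLike.GradedOne.one_mem

/-- Only the part of degree `k` at `p` survives, which lowers the degree by `k`. The case `j < k` is
kept apart because natural subtraction would truncate. -/
theorem evalAt_mem (𝒜 : ℕ → Submodule ℤ A) [SetLike.GradedMonoid 𝒜] {c : A →ₗ[ℤ] ℤ} {k : ℕ}
    (hc : ∀ d, d ≠ k → ∀ a ∈ 𝒜 d, c a = 0) (p : ι) {j : ℕ} {z : ⨂[ℤ] _ : ι, A}
    (hz : z ∈ tensorDegree 𝒜 ι j) :
    evalAt c p z ∈ if k ≤ j then tensorDegree 𝒜 ι (j - k) else ⊥ := by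
  induction hz using Submodule.span_induction with
  | mem z hz =>
    obtain ⟨d, a, ha, rfl, rfl⟩ := hz
    rw [evalAt_tprod]
    by_cases hd : d p = k
    · have hle : d p ≤ ∑ i, d i := Finset.single_le_sum (fun _ _ => Nat.zero_le _) (Finset.mem_univ p)
      rw [if_pos (hd ▸ hle)]
      refine Submodule.smul_mem _ _ (Submodule.subset_span ⟨Function.update d p 0, _, fun i => ?_,
        ?_, rfl⟩)
      · by_cases h : i = p
        · subst h
          simpa using SetLike.GradedOne.one_mem
        · simpa [h] using ha i
      · rw [Finset.sum_update_of_mem (Finset.mem_univ p), ← hd,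
          ← Finset.add_sum_erase _ d (Finset.mem_univ p), Finset.sdiff_singleton_eq_erase]
        omega
    · rw [hc (d p) hd _ (ha p), zero_smul]
      exact Submodule.zero_mem _
  | zero => rw [map_zero]; exact Submodule.zero_mem _
  | add x y _ _ hx hy => rw [map_add]; exact Submodule.add_mem _ hx hy
  | smul r x _ hx => rw [map_smul]; exact Submodule.smul_mem _ r hx

end TensorOperations

/-! ### The basis of `ℤ[x]/(x^m)` -/

section TruncBasis

/-- The basis `1, x, …, x^(m-1)` of `ℤ[x]/(x^m)`, presented by adjoining a root. -/
def adjoinRootPowBasis (m : ℕ) :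
    Module.Basis (Fin m) ℤ (AdjoinRoot ((Polynomial.X : ℤ[X]) ^ m)) :=
  ((AdjoinRoot.powerBasis' (Polynomial.monic_X_pow (R := ℤ) m)).basis).reindex
    (finCongr ((AdjoinRoot.powerBasis'_dim _).trans (Polynomial.natDegree_X_pow m)))

theorem adjoinRootPowBasis_apply (m : ℕ) (k : Fin m) :
    adjoinRootPowBasis m k = AdjoinRoot.mk _ (Polynomial.X ^ (k : ℕ)) := by
  rw [adjoinRootPowBasis, Module.Basis.reindex_apply, PowerBasis.basis_eq_pow, map_pow]
  rfl

/-- The basis `1, x, …, x^(m-1)` of `ℤ[x]/(x^m)`. -/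
def truncBasis (m : ℕ) : Module.Basis (Fin m) ℤ (TruncPoly m) :=
  -- `AdjoinRoot f` is by definition the quotient by the ideal spanned by `f`, so the basis
  -- transfers unchanged.
  adjoinRootPowBasis m

theorem truncBasis_apply (m : ℕ) (k : Fin m) :
    truncBasis m k = Ideal.Quotient.mk _ (Polynomial.X ^ (k : ℕ)) :=
  adjoinRootPowBasis_apply m k

theorem trunc_mk_X_pow {m d : ℕ} (h : m ≤ d) :
    (Ideal.Quotient.mk (Ideal.span {(Polynomial.X : ℤ[X]) ^ m}) (Polynomial.X ^ d)) = 0 :=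
  Ideal.Quotient.eq_zero_iff_mem.2 (Ideal.mem_span_singleton.2 (pow_dvd_pow _ h))

/-- The coefficient of `x^k`. -/
def truncCoeff (m k : ℕ) : TruncPoly m →ₗ[ℤ] ℤ :=
  if h : k < m then (truncBasis m).coord ⟨k, h⟩ else 0

theorem sum_truncCoeff (m : ℕ) (a : TruncPoly m) :
    ∑ k ∈ Finset.range m, truncCoeff m k a • (Ideal.Quotient.mk _ (Polynomial.X ^ k) : TruncPoly m) =
      a := by
  conv_rhs => rw [← (truncBasis m).sum_repr a]
  rw [Finset.sum_range]
  refine Finset.sum_congr rfl fun k _ => ?_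
  rw [truncCoeff, dif_pos k.2, truncBasis_apply]
  rfl

theorem truncCoeff_eq_zero (m k d : ℕ) (h : d ≠ k) (a : TruncPoly m) (ha : a ∈ truncGrading m d) :
    truncCoeff m k a = 0 := by
  obtain ⟨r, rfl⟩ := Submodule.mem_span_singleton.1 ha
  by_cases hk : k < m
  · rcases lt_or_ge d m with hd | hd
    · rw [map_smul, truncCoeff, dif_pos hk]
      have h1 := truncBasis_apply m ⟨d, hd⟩
      simp only at h1
      rw [← h1, Module.Basis.coord_apply, Module.Basis.repr_self, Finsupp.single_apply, if_neg,
        smul_zero]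
      simpa using h
    · rw [trunc_mk_X_pow hd, smul_zero, map_zero]
  · rw [truncCoeff, dif_neg hk, LinearMap.zero_apply]

theorem tensorPower_eq_zero_of_smul {m : ℕ} {ι : Type*} [Finite ι] {n : ℤ} (hn : n ≠ 0)
    {z : ⨂[ℤ] _ : ι, TruncPoly m} (h : n • z = 0) : z = 0 := by
  refine (Basis.piTensorProduct fun _ : ι => truncBasis m).ext_elem fun p => ?_
  have h1 := congrArg (fun y => (Basis.piTensorProduct fun _ : ι => truncBasis m).repr y p) h
  simpa [hn] using h1

/-- By pigeonhole, a pure tensor of so large a degree has a factor of degree at least `m`, which is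
zero. -/
theorem tensorDegree_eq_bot {m : ℕ} {ι : Type*} [Fintype ι] {j : ℕ}
    (h : ((m : ℤ) - 1) * Fintype.card ι < j) : tensorDegree (truncGrading m) ι j = ⊥ := by
  rw [tensorDegree, Submodule.span_eq_bot]
  rintro _ ⟨d, a, ha, hd, rfl⟩
  obtain ⟨c, hc⟩ : ∃ c, m ≤ d c := by
    by_contra! hcon
    have h1 : ∑ c, (d c : ℤ) ≤ ∑ _c : ι, ((m : ℤ) - 1) :=
      Finset.sum_le_sum fun c _ => by have := hcon c; omega
    rw [Finset.sum_const, Finset.card_univ, nsmul_eq_mul, ← Nat.cast_sum, hd, mul_comm] at h1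
    omega
  refine (PiTensorProduct.tprod ℤ).map_coord_zero c ?_
  obtain ⟨r, hr⟩ := Submodule.mem_span_singleton.1 (ha c)
  rw [← hr, trunc_mk_X_pow hc, smul_zero]

end TruncBasis

/-! ### Components of spanning subgraphs -/

section Comp

variable {α β : Type*} [LinearOrder β] (G : Graph α β)

/-- The components of the spanning subgraph `[G : S]`. -/
abbrev Comp (S : Finset β) : Type _ := Component (G.restrict (S : Set β))

/-- The component of a vertex in `[G : S]`. -/
def cmk (S : Finset β) (x : V(G)) : Comp G S := Quot.mk _ x

variable {G}

omit [LinearOrder β] in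
theorem exists_cmk {S : Finset β} (c : Comp G S) : ∃ x, cmk G S x = c := by
  obtain ⟨x, hx⟩ := Quot.exists_rep c
  exact ⟨x, hx⟩

omit [LinearOrder β] in
theorem cmk_eq_of_isLink {S : Finset β} {e : β} (he : e ∈ S) {x y : V(G)} (h : G.IsLink e x y) :
    cmk G S x = cmk G S y :=
  Quot.sound ⟨e, he, h⟩

omit [LinearOrder β] in
/-- A function on vertices that agrees on the ends of each edge is constant on components. -/
theorem eq_of_cmk_eq {S : Finset β} {X : Type*} (f : V(G) → X)
    (hf : ∀ e ∈ S, ∀ x y : V(G), G.IsLink e x y → f x = f y) {x y : V(G)}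
    (h : cmk G S x = cmk G S y) : f x = f y :=
  congrArg (Quot.lift f fun x y hxy => by
    obtain ⟨e, he⟩ := hxy
    exact hf e he.1 x y he.2) h

omit [LinearOrder β] in
theorem cmk_mono {S S' : Finset β} (h : S ⊆ S') {x y : V(G)} (hxy : cmk G S x = cmk G S y) :
    cmk G S' x = cmk G S' y :=
  eq_of_cmk_eq (cmk G S') (fun _ he _ _ hl => cmk_eq_of_isLink (h he) hl) hxy

variable (G) in
/-- The map sending the component of `x` in `[G : S]` to its component in `[G : S']`, if each
component of the former is contained in one of the latter. -/
def push (S S' : Finset β) (c : Comp G S) : Comp G S' := cmk G S' (Quot.out c)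

omit [LinearOrder β] in
theorem cmk_out {S : Finset β} (c : Comp G S) : cmk G S (Quot.out c) = c := Quot.out_eq c

omit [LinearOrder β] in
theorem push_cmk' {S S' : Finset β}
    (h : ∀ x y : V(G), cmk G S x = cmk G S y → cmk G S' x = cmk G S' y) (x : V(G)) :
    push G S S' (cmk G S x) = cmk G S' x :=
  h _ _ (cmk_out _)

omit [LinearOrder β] in
theorem push_cmk {S S' : Finset β} (h : S ⊆ S') (x : V(G)) :
    push G S S' (cmk G S x) = cmk G S' x :=
  push_cmk' (fun _ _ => cmk_mono h) x

omit [LinearOrder β] in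
theorem push_eq_incl {S S' : Finset β} (h : S ⊆ S') :
    push G S S' = Component.incl G (Finset.coe_subset.2 h) := by
  funext c
  obtain ⟨x, rfl⟩ := exists_cmk c
  exact push_cmk h x

omit [LinearOrder β] in
theorem push_push {S S' S'' : Finset β} (h : S ⊆ S') (h' : S' ⊆ S'') :
    push G S' S'' ∘ push G S S' = push G S S'' := by
  funext c
  obtain ⟨x, rfl⟩ := exists_cmk c
  rw [Function.comp_apply, push_cmk h, push_cmk h', push_cmk (h.trans h')]

theorem cmk_eq_of_insert {S : Finset β} {e : β} {x₀ y₀ : V(G)} (he : G.IsLink e x₀ y₀)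
    (h : cmk G S x₀ = cmk G S y₀) {x y : V(G)} (hxy : cmk G (insert e S) x = cmk G (insert e S) y) :
    cmk G S x = cmk G S y := by
  refine eq_of_cmk_eq (cmk G S) (fun f hf x y hl => ?_) hxy
  rcases Finset.mem_insert.1 hf with rfl | hf
  · rcases he.eq_and_eq_or_eq_and_eq hl with ⟨h1, h2⟩ | ⟨h1, h2⟩
    · rwa [← Subtype.ext h1, ← Subtype.ext h2]
    · rw [← Subtype.ext h1, ← Subtype.ext h2, h]
  · exact cmk_eq_of_isLink hf hl

open Classical in
variable (G) in
/-- The section of the map that adds an edge with ends `x₀` and `y₀`, which avoids the component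
of `x₀`. -/
def sec (S S' : Finset β) (x₀ y₀ : V(G)) (c : Comp G S') : Comp G S :=
  if cmk G S (Quot.out c) = cmk G S x₀ then cmk G S y₀ else cmk G S (Quot.out c)

open Classical in
theorem sec_cmk (S : Finset β) {e : β} {x₀ y₀ : V(G)} (he : G.IsLink e x₀ y₀) (x : V(G)) :
    sec G S (insert e S) x₀ y₀ (cmk G (insert e S) x) =
      if cmk G S x = cmk G S x₀ then cmk G S y₀ else cmk G S x := by
  refine eq_of_cmk_eq (fun x => if cmk G S x = cmk G S x₀ then cmk G S y₀ else cmk G S x)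
    (fun f hf x y hl => ?_) (cmk_out (cmk G (insert e S) x))
  rcases Finset.mem_insert.1 hf with rfl | hf
  · rcases he.eq_and_eq_or_eq_and_eq hl with ⟨h1, h2⟩ | ⟨h1, h2⟩
    · rw [← Subtype.ext h1, ← Subtype.ext h2]
      simp
    · rw [← Subtype.ext h1, ← Subtype.ext h2]
      simp
  · simp only [cmk_eq_of_isLink hf hl]

theorem push_sec (S : Finset β) {e : β} {x₀ y₀ : V(G)} (he : G.IsLink e x₀ y₀)
    (c : Comp G (insert e S)) : push G S (insert e S) (sec G S (insert e S) x₀ y₀ c) = c := by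
  classical
  obtain ⟨x, rfl⟩ := exists_cmk c
  rw [sec_cmk S he]
  split_ifs with h
  · rw [push_cmk (Finset.subset_insert _ _)]
    exact (cmk_eq_of_isLink (Finset.mem_insert_self _ _) he).symm.trans
      (cmk_mono (Finset.subset_insert _ _) h).symm
  · exact push_cmk (Finset.subset_insert _ _) x

theorem sec_push_of_ne (S : Finset β) {e : β} {x₀ y₀ : V(G)} (he : G.IsLink e x₀ y₀)
    {c : Comp G S} (hc : c ≠ cmk G S x₀) :
    sec G S (insert e S) x₀ y₀ (push G S (insert e S) c) = c := by
  classical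
  obtain ⟨x, rfl⟩ := exists_cmk c
  rw [push_cmk (Finset.subset_insert _ _), sec_cmk S he, if_neg hc]

theorem sec_ne (S : Finset β) {e : β} {x₀ y₀ : V(G)} (he : G.IsLink e x₀ y₀)
    (hne : cmk G S x₀ ≠ cmk G S y₀) (c : Comp G (insert e S)) :
    sec G S (insert e S) x₀ y₀ c ≠ cmk G S x₀ := by
  classical
  obtain ⟨x, rfl⟩ := exists_cmk c
  rw [sec_cmk S he]
  split_ifs with h
  · exact hne.symm
  · exact h

/-! ### Numbers of components -/

variable [Finite V(G)]

variable (G) in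
/-- The number of components of `[G : T]` inside a given component of `[G : U]`. -/
def fiberCard (T U : Finset β) (c : Comp G U) : ℕ :=
  (Finset.univ.filter fun a : Comp G T => push G T U a = c).card

variable (G) in
/-- The sum, over the components of `[G : U]` that contain at least two components of `[G : T]`, of
the number of components of `[G : T]` they contain minus two. -/
def excess (T U : Finset β) : ℕ := ∑ c : Comp G U, (fiberCard G T U c - 2)

omit [LinearOrder β] in
variable (G) in
theorem sum_fiberCard (T U : Finset β) :
    ∑ c : Comp G U, fiberCard G T U c = Fintype.card (Comp G T) :=
  (Finset.card_eq_sum_card_fiberwise (fun _ _ => Finset.mem_coe.2 (Finset.mem_univ _))).symm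

-- The section `sec` embeds the components after contraction into those before it, missing exactly
-- the component of `x₀`.
open Classical in
theorem fiberCard_insert {T U : Finset β} {e : β} {x₀ y₀ : V(G)}
    (he : G.IsLink e x₀ y₀) (hne : cmk G T x₀ ≠ cmk G T y₀) (hTU : insert e T ⊆ U) (c : Comp G U) :
    fiberCard G (insert e T) U c + (if c = cmk G U x₀ then 1 else 0) = fiberCard G T U c := by
  have hT : T ⊆ insert e T := Finset.subset_insert _ _
  have h1 : (Finset.univ.filter fun a : Comp G T => push G T U a = c).erase (cmk G T x₀) =
      (Finset.univ.filter fun a : Comp G (insert e T) => push G (insert e T) U a = c).image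
        (sec G T (insert e T) x₀ y₀) := by
    ext a
    simp only [Finset.mem_erase, Finset.mem_filter, Finset.mem_univ, true_and, Finset.mem_image]
    constructor
    · rintro ⟨h1, h2⟩
      refine ⟨push G T (insert e T) a, ?_, sec_push_of_ne T he h1⟩
      rw [← h2, ← push_push hT hTU, Function.comp_apply]
    · rintro ⟨b, hb, rfl⟩
      refine ⟨sec_ne T he hne b, ?_⟩
      rw [← push_push hT hTU, Function.comp_apply, push_sec T he, hb]
  have h2 : fiberCard G (insert e T) U c =
      ((Finset.univ.filter fun a : Comp G T => push G T U a = c).erase (cmk G T x₀)).card := by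
    rw [h1, Finset.card_image_of_injective _ (Function.LeftInverse.injective (push_sec T he))]
    rfl
  rw [h2, fiberCard]
  split_ifs with h
  · refine Finset.card_erase_add_one (Finset.mem_filter.2 ⟨Finset.mem_univ _, ?_⟩)
    rw [push_cmk (hT.trans hTU), h]
  · rw [Finset.erase_eq_of_notMem, add_zero]
    rw [Finset.mem_filter, push_cmk (hT.trans hTU)]
    exact fun h' => h h'.2.symm

theorem card_comp_insert {T : Finset β} {e : β} {x₀ y₀ : V(G)}
    (he : G.IsLink e x₀ y₀) (hne : cmk G T x₀ ≠ cmk G T y₀) :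
    Fintype.card (Comp G (insert e T)) + 1 = Fintype.card (Comp G T) := by
  classical
  rw [← sum_fiberCard G T (insert e T), ← sum_fiberCard G (insert e T) (insert e T)]
  simp only [← fiberCard_insert he hne subset_rfl, Finset.sum_add_distrib]
  simp

theorem excess_insert_le {T U : Finset β} {e : β} {x₀ y₀ : V(G)}
    (he : G.IsLink e x₀ y₀) (hne : cmk G T x₀ ≠ cmk G T y₀) (hTU : insert e T ⊆ U) :
    excess G (insert e T) U ≤ excess G T U := by
  classical
  refine Finset.sum_le_sum fun c _ => ?_
  rw [← fiberCard_insert he hne hTU]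
  omega

theorem excess_insert {T U : Finset β} {e : β} {x₀ y₀ : V(G)}
    (he : G.IsLink e x₀ y₀) (hne : cmk G T x₀ ≠ cmk G T y₀) (hTU : insert e T ⊆ U)
    (h3 : 3 ≤ fiberCard G T U (cmk G U x₀)) :
    excess G (insert e T) U + 1 = excess G T U := by
  classical
  rw [excess, excess, ← Finset.add_sum_erase _ _ (Finset.mem_univ (cmk G U x₀)),
    ← Finset.add_sum_erase _ (fun c => fiberCard G T U c - 2) (Finset.mem_univ (cmk G U x₀))]
  have h1 := fiberCard_insert he hne hTU (cmk G U x₀)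
  rw [if_pos rfl] at h1
  have h2 : ∑ c ∈ Finset.univ.erase (cmk G U x₀), (fiberCard G (insert e T) U c - 2) =
      ∑ c ∈ Finset.univ.erase (cmk G U x₀), (fiberCard G T U c - 2) := by
    refine Finset.sum_congr rfl fun c hc => ?_
    rw [← fiberCard_insert he hne hTU c, if_neg (Finset.ne_of_mem_erase hc), add_zero]
  omega

omit [Finite V(G)] in
theorem push_erase_bijective {U : Finset β} {e : β} (heU : e ∈ U) {x₀ y₀ : V(G)}
    (he : G.IsLink e x₀ y₀) (h : cmk G (U.erase e) x₀ = cmk G (U.erase e) y₀) :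
    Function.Bijective (push G (U.erase e) U) := by
  constructor
  · intro c c' hcc
    obtain ⟨x, rfl⟩ := exists_cmk c
    obtain ⟨y, rfl⟩ := exists_cmk c'
    rw [push_cmk (Finset.erase_subset _ _), push_cmk (Finset.erase_subset _ _)] at hcc
    refine cmk_eq_of_insert he h ?_
    rwa [Finset.insert_erase heU]
  · intro c
    obtain ⟨x, rfl⟩ := exists_cmk c
    exact ⟨_, push_cmk (Finset.erase_subset _ _) x⟩

theorem card_comp_erase {U : Finset β} {e : β} (heU : e ∈ U) {x₀ y₀ : V(G)}
    (he : G.IsLink e x₀ y₀) (h : cmk G (U.erase e) x₀ = cmk G (U.erase e) y₀) :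
    Fintype.card (Comp G (U.erase e)) = Fintype.card (Comp G U) :=
  Fintype.card_of_bijective (push_erase_bijective heU he h)

theorem excess_erase {T U : Finset β} {e : β} (heU : e ∈ U) {x₀ y₀ : V(G)}
    (he : G.IsLink e x₀ y₀) (h : cmk G (U.erase e) x₀ = cmk G (U.erase e) y₀)
    (hTU : T ⊆ U.erase e) : excess G T (U.erase e) = excess G T U := by
  have hb := push_erase_bijective heU he h
  refine Fintype.sum_bijective _ hb _ _ fun c => ?_
  rw [fiberCard, fiberCard]
  congr 2
  ext a
  rw [← push_push hTU (Finset.erase_subset _ _)]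
  simp only [Finset.mem_filter, Finset.mem_univ, true_and, Function.comp_apply, hb.1.eq_iff]

/-! ### Loops, cycles and leaves -/

/-- If the ends of `e` are still connected when `e` is deleted, and their component contains no
other vertices of the contracted graph, then the contraction of `e` has a loop. -/
theorem exists_loop_insert {T U : Finset β} {e : β} (heU : e ∈ U) (hTU : T ⊆ U) {x₀ y₀ : V(G)}
    (he : G.IsLink e x₀ y₀) (hne : cmk G T x₀ ≠ cmk G T y₀)
    (h : cmk G (U.erase e) x₀ = cmk G (U.erase e) y₀) (h2 : fiberCard G T U (cmk G U x₀) ≤ 2) :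
    ∃ f ∈ U, f ∉ insert e T ∧ ∃ x y : V(G), G.IsLink f x y ∧
      cmk G (insert e T) x = cmk G (insert e T) y := by
  classical
  by_contra! hcon
  have hT : T ⊆ insert e T := Finset.subset_insert _ _
  have hxy : cmk G (insert e T) x₀ = cmk G (insert e T) y₀ :=
    cmk_eq_of_isLink (Finset.mem_insert_self _ _) he
  -- An edge other than `e` at the vertex of `x₀` would have its other end at `x₀` or `y₀`, as a
  -- third vertex would exceed the count. It would then become a loop once `e` is contracted.
  have key : ∀ f ∈ U, f ∉ insert e T → ∀ x y : V(G), G.IsLink f x y → cmk G T x ≠ cmk G T x₀ := by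
    intro f hf hfT x y hl hx
    have h3 : cmk G T y = cmk G T x₀ ∨ cmk G T y = cmk G T y₀ := by
      by_contra! h4
      have h5 : ({cmk G T y, cmk G T x₀, cmk G T y₀} : Finset (Comp G T)) ⊆
          Finset.univ.filter fun a : Comp G T => push G T U a = cmk G U x₀ := by
        intro a ha
        simp only [Finset.mem_insert, Finset.mem_singleton] at ha
        simp only [Finset.mem_filter, Finset.mem_univ, true_and]
        rcases ha with rfl | rfl | rfl
        · rw [push_cmk hTU, ← cmk_eq_of_isLink hf hl]
          exact cmk_mono hTU hx
        · exact push_cmk hTU _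
        · rw [push_cmk hTU]
          exact (cmk_eq_of_isLink heU he).symm
      have h6 := (Finset.card_le_card h5).trans h2
      rw [Finset.card_eq_three.2 ⟨_, _, _, h4.1, h4.2, hne, rfl⟩] at h6
      omega
    refine hcon f hf hfT x y hl ((cmk_mono hT hx).trans ?_)
    rcases h3 with h3 | h3
    · exact (cmk_mono hT h3).symm
    · exact hxy.trans (cmk_mono hT h3).symm
  -- Hence no edge except `e` meets the vertex of `x₀`, so membership in it is constant on
  -- components of the deletion, against `h`.
  have h7 := eq_of_cmk_eq (fun x => cmk G T x = cmk G T x₀) (fun f hf x y hl => by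
    obtain ⟨hfe, hfU⟩ := Finset.mem_erase.1 hf
    by_cases hfT : f ∈ T
    · simp only [cmk_eq_of_isLink hfT hl]
    · have hfT' : f ∉ insert e T := by simp [hfe, hfT]
      simp only [key f hfU hfT' x y hl, key f hfU hfT' y x hl.symm]) h
  exact hne (h7.mp rfl).symm

/-- The vertex `x₀` of the graph with edges `U \ T` obtained by contracting `T` is a leaf, on the
edge `e`. -/
def IsLeaf (T U : Finset β) (e : β) (x₀ : V(G)) : Prop :=
  ∀ f ∈ U, f ∉ T → f ≠ e → ∀ x y : V(G), G.IsLink f x y → cmk G T x ≠ cmk G T x₀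

omit [Finite V(G)] in
/-- A forest with an edge has a leaf different from a given vertex. -/
theorem exists_leaf {U : Finset β} (hU : (U : Set β) ⊆ E(G)) {T : Finset β} (hTU : T ⊂ U)
    (hb : ∀ e ∈ U, e ∉ T → ∀ x y : V(G), G.IsLink e x y →
      cmk G (U.erase e) x ≠ cmk G (U.erase e) y) (r : V(G)) :
    ∃ e ∈ U, e ∉ T ∧ ∃ x₀ y₀ : V(G), G.IsLink e x₀ y₀ ∧ cmk G T x₀ ≠ cmk G T r ∧
      IsLeaf T U e x₀ := by
  induction hn : (U \ T).card generalizing T r with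
  | zero =>
    rw [Finset.card_eq_zero, Finset.sdiff_eq_empty_iff_subset] at hn
    exact absurd hn hTU.2
  | succ n ih =>
    -- If `e` meets the root, contract it into the root and take a leaf of the smaller forest. If
    -- `e` was the last edge, its far end is a leaf.
    have main : ∀ r : V(G), ∀ e ∈ U, e ∉ T → ∀ a b : V(G), G.IsLink e a b →
        cmk G T a = cmk G T r → ∃ e ∈ U, e ∉ T ∧ ∃ x₀ y₀ : V(G), G.IsLink e x₀ y₀ ∧
          cmk G T x₀ ≠ cmk G T r ∧ IsLeaf T U e x₀ := by
      intro r e heU heT a b hl har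
      have hT : T ⊆ insert e T := Finset.subset_insert _ _
      rcases (Finset.insert_subset heU hTU.1).eq_or_ssubset with h | h
      · refine ⟨e, heU, heT, b, a, hl.symm, ?_, ?_⟩
        · rw [← har]
          exact fun h' => hb e heU heT a b hl
            (cmk_mono (Finset.subset_erase.2 ⟨hTU.1, heT⟩) h').symm
        · intro f hf hfT hfe
          rw [← h, Finset.mem_insert] at hf
          exact absurd hf (not_or.2 ⟨hfe, hfT⟩)
      · obtain ⟨f, hfU, hfT, x₀, y₀, hl', hx₀, hleaf⟩ := ih h
          (fun f hf hfT => hb f hf fun h => hfT (hT h)) r (by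
            rw [Finset.sdiff_insert, Finset.card_erase_of_mem (Finset.mem_sdiff.2 ⟨heU, heT⟩), hn]
            rfl)
        refine ⟨f, hfU, fun h => hfT (hT h), x₀, y₀, hl', fun h => hx₀ (cmk_mono hT h), ?_⟩
        intro g hgU hgT hgf x y hg hx
        -- Both ends of `e` become the root under contraction, so `e` cannot meet the leaf, which
        -- differs from the root.
        by_cases hge : g = e
        · subst hge
          refine hx₀ ((cmk_mono hT hx).symm.trans (Eq.trans ?_ (cmk_mono hT har)))
          rcases hl.eq_and_eq_or_eq_and_eq hg with ⟨h1, h2⟩ | ⟨h1, h2⟩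
          · rw [← Subtype.ext h1]
          · rw [← Subtype.ext h2]
            exact (cmk_eq_of_isLink (Finset.mem_insert_self _ _) hl).symm
        · exact hleaf g hgU (by simp [hge, hgT]) hgf x y hg (cmk_mono hT hx)
    by_cases h : ∃ e ∈ U, e ∉ T ∧ ∃ a b : V(G), G.IsLink e a b ∧ cmk G T a = cmk G T r
    · obtain ⟨e, heU, heT, a, b, hl, har⟩ := h
      exact main r e heU heT a b hl har
    -- No edge meets `r`: root the forest at an end of any edge. The leaf obtained is an end of an
    -- edge, hence different from `r`.
    · obtain ⟨e, heU, heT⟩ := Finset.exists_of_ssubset hTU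
      obtain ⟨a, b, hl⟩ := G.exists_isLink_of_mem_edgeSet (hU heU)
      obtain ⟨f, hfU, hfT, x₀, y₀, hl', -, hleaf⟩ :=
        main ⟨a, hl.left_mem⟩ e heU heT ⟨a, hl.left_mem⟩ ⟨b, hl.right_mem⟩ hl rfl
      exact ⟨f, hfU, hfT, x₀, y₀, hl', fun h' => h ⟨f, hfU, hfT, x₀, y₀, hl', h'⟩, hleaf⟩

-- Without `e`, no edge connects the leaf to anything, so its component never grows. This makes the
-- tensor factor at the leaf invisible to all maps that do not add `e`.
omit [Finite V(G)] in
theorem IsLeaf.cmk_eq {T U S : Finset β} {e : β} {x₀ : V(G)} (h : IsLeaf T U e x₀)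
    (hSU : S ⊆ U) (heS : e ∉ S) {x : V(G)} (hx : cmk G S x = cmk G S x₀) :
    cmk G T x = cmk G T x₀ := by
  have h7 := eq_of_cmk_eq (fun x => cmk G T x = cmk G T x₀) (fun f hf x y hl => by
    by_cases hfT : f ∈ T
    · simp only [cmk_eq_of_isLink hfT hl]
    · have hfe : f ≠ e := fun h => heS (h ▸ hf)
      simp only [h f (hSU hf) hfT hfe x y hl, h f (hSU hf) hfT hfe y x hl.symm]) hx
  exact h7.mpr rfl

end Comp

/-- Multiplication by a tensor, as a linear map. -/
def mulLeftTensor {A ι : Type*} [CommRing A] (u : ⨂[ℤ] _ : ι, A) :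
    (⨂[ℤ] _ : ι, A) →ₗ[ℤ] ⨂[ℤ] _ : ι, A where
  toFun z := u * z
  map_add' := mul_add u
  map_smul' r z := mul_smul_comm r u z

theorem mulLeftTensor_apply {A ι : Type*} [CommRing A] (u z : ⨂[ℤ] _ : ι, A) :
    mulLeftTensor u z = u * z := rfl

/-! ### The chromatic complexes of minors -/

section Minor

variable {α β : Type*} [LinearOrder β] (G : Graph α β) [Finite V(G)] (m : ℕ)

/-- The tensor power of `A_m` indexed by the components of `[G : S]`. -/
abbrev ChromaticModule (S : Finset β) : Type _ := ⨂[ℤ] _ : Comp G S, TruncPoly m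

/-- The map of tensor powers that multiplies the factors of components that become joined. -/
def chromaticMap (S S' : Finset β) : ChromaticModule G m S →ₗ[ℤ] ChromaticModule G m S' :=
  mergeMap (TruncPoly m) (push G S S')

/-- The degree `j` part of the tensor powers. -/
def chromaticDegree (j : ℕ) (S : Finset β) : Submodule ℤ (ChromaticModule G m S) :=
  tensorDegree (truncGrading m) (Comp G S) j

theorem isCubeSign_sign : IsCubeSign (sign : Finset β → β → ℤ) where
  mul_self S e := by rw [sign, ← mul_pow]; simp
  anticomm _ _ _ he hf hef := sign_mul_sign he hf hef

variable {G m}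

omit [LinearOrder β] in
theorem chromaticMap_mul {S S' : Finset β} (y z : ChromaticModule G m S) :
    chromaticMap G m S S' (y * z) = chromaticMap G m S S' y * chromaticMap G m S S' z :=
  mergeMap_mul _ y z

omit [LinearOrder β] in
theorem chromaticMap_singleTensor {S S' : Finset β} (h : S ⊆ S') (x : V(G)) (a : TruncPoly m) :
    chromaticMap G m S S' (singleTensor (cmk G S x) a) = singleTensor (cmk G S' x) a := by
  rw [chromaticMap, mergeMap_singleTensor, push_cmk h]

omit [LinearOrder β] in
theorem isCubeFunctor_chromaticMap :
    IsCubeFunctor (R := ℤ) (M := ChromaticModule G m) (chromaticMap G m) := by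
  intro S S' S'' h h' x
  rw [chromaticMap, chromaticMap, mergeMap_mergeMap, push_push h h', chromaticMap]

omit [LinearOrder β] in
theorem chromaticMap_mem (j : ℕ) (S S' : Finset β) (x : ChromaticModule G m S)
    (hx : x ∈ chromaticDegree G m j S) : chromaticMap G m S S' x ∈ chromaticDegree G m j S' :=
  mergeMap_mem_tensorDegree _ _ hx

omit [LinearOrder β] in
theorem isCubeStable_chromaticDegree (j : ℕ) :
    IsCubeStable (R := ℤ) (M := ChromaticModule G m) (chromaticMap G m) (chromaticDegree G m j) :=
  fun _ _ _ => chromaticMap_mem j _ _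

variable (G m) in
/-- The classes at height `I` and degree `j` annihilated by `n` vanish in the chromatic complex of the
minor of `G` obtained by contracting `T` and deleting the edges outside `U`. -/
abbrev ChromaticExact (T U : Finset β) (I : ℤ) (j : ℕ) (n : ℤ) : Prop :=
  CubeExact (R := ℤ) (M := ChromaticModule G m) sign (chromaticMap G m) (chromaticDegree G m j)
    T U I n

variable {T U : Finset β} {I : ℤ} {j : ℕ} {n : ℤ}

/-- A loop leaves the partition into components unchanged, so `push` in the two directions gives
mutually inverse maps. -/
theorem chromaticExact_of_loop {e : β} (heT : e ∉ T) (heU : e ∈ U) {x₀ y₀ : V(G)}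
    (he : G.IsLink e x₀ y₀) (h : cmk G T x₀ = cmk G T y₀) : ChromaticExact G m T U I j n := by
  refine cubeExact_of_bijective (R := ℤ) (M := ChromaticModule G m) isCubeSign_sign
    isCubeFunctor_chromaticMap heT heU
    (fun S S' => chromaticMap G m S' S) (fun S S' => chromaticMap_mem j S' S) ?_ ?_
  · intro S hTS _ x
    have h1 : push G (insert e S) S ∘ push G S (insert e S) = id := by
      funext c
      obtain ⟨x, rfl⟩ := exists_cmk c
      rw [Function.comp_apply, push_cmk (Finset.subset_insert _ _),
        push_cmk' fun _ _ => cmk_eq_of_insert he (cmk_mono hTS h)]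
      rfl
    rw [chromaticMap, chromaticMap, mergeMap_mergeMap, h1, mergeMap_id]
  · intro S hTS _ x
    have h1 : push G S (insert e S) ∘ push G (insert e S) S = id := by
      funext c
      obtain ⟨x, rfl⟩ := exists_cmk c
      rw [Function.comp_apply, push_cmk' fun _ _ => cmk_eq_of_insert he (cmk_mono hTS h),
        push_cmk (Finset.subset_insert _ _)]
      rfl
    rw [chromaticMap, chromaticMap, mergeMap_mergeMap, h1, mergeMap_id]

/-- The class of `x^k` in `A_m`. -/
def truncX (m k : ℕ) : TruncPoly m := Ideal.Quotient.mk _ (Polynomial.X ^ k)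

theorem truncX_mem (m k : ℕ) : truncX m k ∈ truncGrading m k := Submodule.subset_span rfl

omit [LinearOrder β] in
theorem singleTensor_truncX_mul_mem {S : Finset β} (c : Comp G S) {k : ℕ}
    {y : ChromaticModule G m S}
    (hy : y ∈ if k ≤ j then chromaticDegree G m (j - k) S else ⊥) :
    singleTensor c (truncX m k) * y ∈ chromaticDegree G m j S := by
  split_ifs at hy with h
  · exact mul_mem_tensorDegree _ (Nat.add_sub_of_le h) (singleTensor_mem _ (truncX_mem m k) c) hy
  · rw [(Submodule.mem_bot ℤ).1 hy, mul_zero]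
    exact Submodule.zero_mem _

omit [LinearOrder β] in
theorem mergeMap_mem_ite {S S' : Finset β} (f : Comp G S → Comp G S') {k : ℕ}
    {y : ChromaticModule G m S}
    (hy : y ∈ if k ≤ j then chromaticDegree G m (j - k) S else ⊥) :
    mergeMap (TruncPoly m) f y ∈ if k ≤ j then chromaticDegree G m (j - k) S' else ⊥ := by
  split_ifs at hy ⊢ with h
  · exact mergeMap_mem_tensorDegree _ _ hy
  · rw [(Submodule.mem_bot ℤ).1 hy, map_zero]
    exact Submodule.zero_mem _

/-- Let $p$ be the leaf and $q$ its neighbour. Adding `e` multiplies the factor at $p$ into the one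
at $q$. The kernel of this map is the sum over $1 \le k < m$ of the multiples of $x_p^k - x_q^k$ by
tensors with trivial factor at $p$, that is, by tensors on the contraction. -/
theorem chromaticExact_of_leaf {e : β} (heT : e ∉ T) (heU : e ∈ U) {x₀ y₀ : V(G)}
    (he : G.IsLink e x₀ y₀) (hne : cmk G T x₀ ≠ cmk G T y₀) (hleaf : IsLeaf T U e x₀)
    (hE : ∀ k, 1 ≤ k → k < m → k ≤ j → ChromaticExact G m (insert e T) U (I + 1) (j - k) n) :
    ChromaticExact G m T U I j n := by
  classical
  have hcmk : ∀ S, T ⊆ S → S ⊆ U → e ∉ S → ∀ S', S ⊆ S' → S' ⊆ U → e ∉ S' → ∀ c : Comp G S,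
      push G S S' c = cmk G S' x₀ ↔ c = cmk G S x₀ := by
    intro S hTS hSU heS S' hSS hSU' heS' c
    obtain ⟨x, rfl⟩ := exists_cmk c
    rw [push_cmk hSS]
    exact ⟨fun h => cmk_mono hTS (hleaf.cmk_eq hSU' heS' h), cmk_mono hSS⟩
  have hneS : ∀ S, S ⊆ U → e ∉ S → cmk G S x₀ ≠ cmk G S y₀ := fun S hSU heS h =>
    hne (hleaf.cmk_eq hSU heS h.symm).symm
  have hse : ∀ S : Finset β, S ⊆ insert e S := fun S => Finset.subset_insert _ _
  have hxy : ∀ S : Finset β, cmk G (insert e S) x₀ = cmk G (insert e S) y₀ := fun S =>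
    cmk_eq_of_isLink (Finset.mem_insert_self _ _) he
  let ι : ∀ S S', ChromaticModule G m S' →ₗ[ℤ] ChromaticModule G m S := fun S S' =>
    mergeMap (TruncPoly m) (sec G S S' x₀ y₀)
  let u : ℕ → ∀ S, ChromaticModule G m S := fun k S =>
    singleTensor (cmk G S x₀) (truncX m k) - singleTensor (cmk G S y₀) (truncX m k)
  let θ : {k // k ∈ Finset.Ico 1 m} → ∀ S S', ChromaticModule G m S' →ₗ[ℤ] ChromaticModule G m S :=
    fun k S S' => mulLeftTensor (u k S) ∘ₗ ι S S'
  let ρ : {k // k ∈ Finset.Ico 1 m} → ∀ S S', ChromaticModule G m S →ₗ[ℤ] ChromaticModule G m S' :=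
    fun k S S' => chromaticMap G m S S' ∘ₗ evalAt (truncCoeff m k) (cmk G S x₀)
  have hι : ∀ S, ∀ x, chromaticMap G m S (insert e S) (ι S (insert e S) x) = x := by
    intro S x
    have h1 : push G S (insert e S) ∘ sec G S (insert e S) x₀ y₀ = id :=
      funext fun c => push_sec S he c
    simp only [ι, chromaticMap, mergeMap_mergeMap, h1, mergeMap_id]
  have hιnat : LowerNatural (R := ℤ) (M := ChromaticModule G m) (chromaticMap G m) e T U ι := by
    intro S S' hTS hSS hSU heS' x
    have heS : e ∉ S := fun h => heS' (hSS h)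
    simp only [ι, chromaticMap, mergeMap_mergeMap]
    congr 2
    funext c
    obtain ⟨x, rfl⟩ := exists_cmk c
    simp only [Function.comp_apply]
    have h1 : cmk G S' x = cmk G S' x₀ ↔ cmk G S x = cmk G S x₀ := by
      rw [← push_cmk hSS x]
      exact hcmk S hTS (hSS.trans hSU) heS S' hSS hSU heS' _
    rw [push_cmk (Finset.insert_subset_insert e hSS), sec_cmk S he, sec_cmk S' he]
    by_cases h2 : cmk G S x = cmk G S x₀
    · rw [if_pos h2, if_pos (h1.2 h2), push_cmk hSS]
    · rw [if_neg h2, if_neg (h1.not.2 h2), push_cmk hSS]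
  have hu : ∀ k S S', S ⊆ S' → chromaticMap G m S S' (u k S) = u k S' := by
    intro k S S' h
    simp only [u, map_sub, chromaticMap_singleTensor h]
  refine cubeExact_of_pendant (R := ℤ) (M := ChromaticModule G m) isCubeSign_sign
    isCubeFunctor_chromaticMap
    (isCubeStable_chromaticDegree j) heT heU (K := {k // k ∈ Finset.Ico 1 m}) (ι := ι) (θ := θ) (ρ := ρ)
    -- Copies with `k > j` must be zero: `j - k` would be truncated to `0`.
    (L' := fun k S => if (k : ℕ) ≤ j then chromaticDegree G m (j - k) S else ⊥)
    ?_ ?_ ?_ ?_ ?_ ?_ ?_ ?_ ?_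
  · intro S S' x hx
    exact mergeMap_mem_tensorDegree _ _ hx
  · intro k S S' x hx
    simp only [θ, u, LinearMap.comp_apply, mulLeftTensor_apply, sub_mul]
    exact Submodule.sub_mem _ (singleTensor_truncX_mul_mem _ (mergeMap_mem_ite _ hx))
      (singleTensor_truncX_mul_mem _ (mergeMap_mem_ite _ hx))
  · intro k S S' x hx
    exact mergeMap_mem_ite _ (evalAt_mem _ (truncCoeff_eq_zero m k) _ hx)
  · intro S _ _ _ x
    exact hι S x
  · intro k S _ _ _ x
    have h1 : chromaticMap G m S (insert e S) (u k S) = 0 := by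
      simp only [u, map_sub, chromaticMap_singleTensor (hse S), hxy, sub_self]
    simp only [θ, LinearMap.comp_apply, mulLeftTensor_apply]
    rw [chromaticMap_mul, h1, zero_mul]
  · intro S hTS hSU heS x hx
    have h1 : ∀ k, ι S (insert e S) (chromaticMap G m S (insert e S)
        (evalAt (truncCoeff m k) (cmk G S x₀) x)) = evalAt (truncCoeff m k) (cmk G S x₀) x := by
      intro k
      simp only [ι, chromaticMap, mergeMap_mergeMap]
      refine mergeMap_evalAt _ _ _ ?_ ?_ x
      · exact sec_ne S he (hneS S hSU heS) _
      · intro c hc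
        exact sec_push_of_ne S he hc
    have h3 : sec G S (insert e S) x₀ y₀ (cmk G (insert e S) y₀) = cmk G S y₀ := by
      rw [sec_cmk S he, ite_self]
    have hsum := eq_sum_singleTensor_mul_evalAt (Finset.range m) (truncCoeff m) (truncX m)
      (sum_truncCoeff m) (cmk G S x₀) x
    -- Expand `x` in powers of the variable at the leaf and apply the map that moves the leaf factor
    -- to the neighbour. Since `x` is in the kernel, the result is zero; subtracting it from the
    -- expansion produces the differences `u k S`.
    have h0 : ∑ k ∈ Finset.range m, singleTensor (cmk G S y₀) (truncX m k) *
        evalAt (truncCoeff m k) (cmk G S x₀) x = 0 := by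
      have h4 := congrArg (fun y => ι S (insert e S) (chromaticMap G m S (insert e S) y)) hsum
      simp only [hx, map_zero, map_sum] at h4
      rw [h4]
      refine Finset.sum_congr rfl fun k _ => ?_
      rw [chromaticMap_mul, chromaticMap_singleTensor (hse S), hxy]
      refine Eq.trans ?_ (mergeMap_mul _ _ _).symm
      rw [mergeMap_singleTensor, h3]
      exact congrArg _ (h1 k).symm
    refine Eq.trans ?_ (Finset.sum_coe_sort (Finset.Ico 1 m) (fun k => mulLeftTensor (u k S)
      (ι S (insert e S) (chromaticMap G m S (insert e S)
        (evalAt (truncCoeff m k) (cmk G S x₀) x))))).symm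
    simp only [h1, mulLeftTensor_apply]
    rw [Finset.sum_subset (s₂ := Finset.range m)]
    · simp only [u, sub_mul, Finset.sum_sub_distrib]
      rw [h0, sub_zero]
      exact hsum
    · intro k hk
      exact Finset.mem_range.2 (Finset.mem_Ico.1 hk).2
    -- The term `k = 0` drops out because the zeroth powers at the two vertices agree.
    · intro k hk hk'
      obtain rfl : k = 0 := by
        rw [Finset.mem_Ico, Finset.mem_range] at *
        omega
      have h5 : truncX m 0 = 1 := by simp [truncX]
      simp only [u, h5, singleTensor_one, sub_self, zero_mul]
  · intro k S S' hTS hSS hSU heS' x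
    simp only [θ, LinearMap.comp_apply, mulLeftTensor_apply]
    rw [← hιnat S S' hTS hSS hSU heS', chromaticMap_mul, hu _ _ _ hSS]
  · intro k S S' hTS hSS hSU heS' x
    have heS : e ∉ S := fun h => heS' (hSS h)
    simp only [ρ, LinearMap.comp_apply]
    have h1 := evalAt_mergeMap (truncCoeff m k) (push G S S') (cmk G S x₀) (by
      intro c hc
      rw [push_cmk hSS] at hc
      exact (hcmk S hTS (hSS.trans hSU) heS S' hSS hSU heS' c).1 hc) x
    rw [push_cmk hSS] at h1
    refine (congrArg (chromaticMap G m S' (insert e S')) h1).trans ?_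
    refine Eq.trans (isCubeFunctor_chromaticMap _ _ _ hSS (hse S') _) ?_
    rw [isCubeFunctor_chromaticMap _ _ _ (hse S) (Finset.insert_subset_insert e hSS)]
  · intro k
    obtain ⟨h1, h2⟩ := Finset.mem_Ico.1 k.2
    by_cases h : (k : ℕ) ≤ j
    · simp only [h, if_true]
      exact hE k h1 h2 h
    · simp only [h, if_false]
      exact cubeExact_bot

end Minor

/-! ### Vanishing range for minors, by deletion and contraction -/

section Vanishing

variable {α β : Type*} [LinearOrder β] {G : Graph α β} [Finite V(G)] {m : ℕ}

/-- Torsion-freeness in the lowest height. -/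
theorem chromaticExact_of_card_eq {T U : Finset β} {j : ℕ} {n : ℤ} (hn : n ≠ 0) :
    ChromaticExact G m T U T.card j n := by
  intro z w hz _ _ hnz
  refine ⟨0, fun S => Submodule.zero_mem _, fun S hTS hSU hS => ?_⟩
  obtain rfl := Finset.eq_of_subset_of_card_le hTS (by omega)
  rw [map_zero, Pi.zero_apply]
  refine tensorPower_eq_zero_of_smul hn ((hnz T hTS hSU hS).trans (cubeD_eq_zero fun e he he' => ?_))
  exact absurd he he'

theorem chromaticExact_self {T : Finset β} {I : ℤ} {j : ℕ} {n : ℤ} (h : I ≠ T.card) :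
    ChromaticExact G m T T I j n := by
  intro z w hz _ _ hnz
  refine ⟨0, fun S => Submodule.zero_mem _, fun S hTS hST hS => ?_⟩
  obtain rfl := hTS.antisymm hST
  exact absurd hS.symm h

theorem chromaticExact_of_degree {T : Finset β} {I : ℤ} {j : ℕ} {n : ℤ}
    (h : ((m : ℤ) - 1) * Fintype.card (Comp G T) < j) : ChromaticExact G m T T I j n := by
  intro z w hz _ _ hnz
  refine ⟨0, fun S => Submodule.zero_mem _, fun S hTS hST _ => ?_⟩
  obtain rfl := hTS.antisymm hST
  rw [map_zero, Pi.zero_apply]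
  have h1 := hz T
  rw [chromaticDegree, tensorDegree_eq_bot h] at h1
  exact (Submodule.mem_bot ℤ).1 h1

variable (G m) in
/-- The range of heights `I` and degrees `j` in which the chromatic cohomology of the minor of `G`
obtained by contracting `T` and deleting the edges outside `U` can be nonzero. -/
def InRange (T U : Finset β) (I : ℤ) (j : ℕ) : Prop :=
  I ≤ T.card + excess G T U ∧
  (Fintype.card (Comp G T) : ℤ) + T.card ≤ I + j + Fintype.card (Comp G U) ∧
  ((m : ℤ) - 1) * (I - T.card) + j ≤ ((m : ℤ) - 1) * Fintype.card (Comp G T)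

/-- The vanishing range of the chromatic cohomology of minors, and the absence of torsion on the
lower boundary of its support. -/
theorem chromaticExact_of_not_inRange {T U : Finset β} (hU : (U : Set β) ⊆ E(G)) (hTU : T ⊆ U) :
    (∀ I j, ¬ InRange G m T U I j → ChromaticExact G m T U I j 0) ∧
    (∀ (I : ℤ) (j : ℕ), I + j + Fintype.card (Comp G U) ≤ Fintype.card (Comp G T) + T.card →
      ∀ n ≠ 0, ChromaticExact G m T U I j n) := by
  induction hN : (U \ T).card generalizing T U with
  | zero =>
    rw [Finset.card_eq_zero, Finset.sdiff_eq_empty_iff_subset] at hN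
    obtain rfl := hTU.antisymm hN
    constructor
    · intro I j h
      by_cases hI : I = T.card
      · refine chromaticExact_of_degree ?_
        by_contra! hj
        subst hI
        refine h ⟨by omega, by omega, ?_⟩
        rw [sub_self, mul_zero, zero_add]
        exact hj
      · exact chromaticExact_self hI
    · intro I j _ n hn
      by_cases hI : I = T.card
      · subst hI
        exact chromaticExact_of_card_eq hn
      · exact chromaticExact_self hI
  | succ N ih =>
    by_cases hloop : ∃ e ∈ U, e ∉ T ∧ ∃ x y : V(G), G.IsLink e x y ∧ cmk G T x = cmk G T y
    · obtain ⟨e, heU, heT, x, y, he, hxy⟩ := hloop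
      exact ⟨fun I j _ => chromaticExact_of_loop heT heU he hxy,
        fun I j _ n _ => chromaticExact_of_loop heT heU he hxy⟩
    by_cases hcyc : ∃ e ∈ U, e ∉ T ∧ ∃ x y : V(G), G.IsLink e x y ∧
        cmk G (U.erase e) x = cmk G (U.erase e) y
    · obtain ⟨e, heU, heT, x, y, he, hxy⟩ := hcyc
      have hne : cmk G T x ≠ cmk G T y := fun h => hloop ⟨e, heU, heT, x, y, he, h⟩
      have hTe : insert e T ⊆ U := Finset.insert_subset heU hTU
      have hTU' : T ⊆ U.erase e := Finset.subset_erase.2 ⟨hTU, heT⟩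
      have heD : e ∈ U \ T := Finset.mem_sdiff.2 ⟨heU, heT⟩
      have hv := card_comp_insert he hne
      have hμ := card_comp_erase heU he hxy
      have hex := excess_erase heU he hxy hTU'
      have hcard := Finset.card_insert_of_notMem heT
      obtain ⟨hd0, hd1⟩ := ih (T := T) (U := U.erase e)
        ((Finset.coe_subset.2 (Finset.erase_subset _ _)).trans hU) hTU' (by
          rw [Finset.erase_sdiff_comm, Finset.card_erase_of_mem heD, hN]
          rfl)
      -- The range of the contraction is contained in that of the minor itself: the changes of
      -- `T.card`, of the number of vertices and of the excess cancel. When the excess does not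
      -- drop, the contraction has a loop.
      have hc : (∀ I j, ¬ InRange G m T U I j → ChromaticExact G m (insert e T) U I j 0) ∧
          (∀ (I : ℤ) (j : ℕ),
            I + j + Fintype.card (Comp G U) ≤ Fintype.card (Comp G T) + T.card →
            ∀ n ≠ 0, ChromaticExact G m (insert e T) U I j n) := by
        obtain ⟨hc0, hc1⟩ := ih (T := insert e T) (U := U) hU hTe (by
          rw [Finset.sdiff_insert, Finset.card_erase_of_mem heD, hN]
          rfl)
        refine ⟨fun I j h => ?_, fun I j h n hn => hc1 I j (by omega) n hn⟩
        rcases le_or_gt 3 (fiberCard G T U (cmk G U x)) with h3 | h3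
        · have hex' := excess_insert he hne hTe h3
          refine hc0 I j fun ⟨h1, h2, h4⟩ => h ⟨by omega, by omega, ?_⟩
          rw [hcard] at h4
          rw [← hv]
          push_cast at h4 ⊢
          linarith
        · obtain ⟨f, hfU, hfT, a, b, hl, hab⟩ :=
            exists_loop_insert heU hTU he hne hxy (by omega)
          exact chromaticExact_of_loop hfT hfU hl hab
      constructor
      · intro I j h
        refine cubeExact_of_delete_of_contract isCubeSign_sign isCubeFunctor_chromaticMap
          (isCubeStable_chromaticDegree j) heT (hc.1 I j h) (hd0 I j ?_) (Or.inl rfl)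
        rwa [InRange, hex, hμ]
      · intro I j h n hn
        refine cubeExact_of_delete_of_contract isCubeSign_sign isCubeFunctor_chromaticMap
          (isCubeStable_chromaticDegree j) heT (hc.2 I j h n hn) (hd1 I j (by omega) n hn)
          -- At height `I - 1` the deletion is strictly below the lower line, so its cohomology
          -- vanishes.
          (Or.inr (hd0 (I - 1) j fun h' => ?_))
        have := h'.2.1
        omega
    · have hTU' : T ⊂ U := by
        refine ⟨hTU, fun h => ?_⟩
        rw [Finset.sdiff_eq_empty_iff_subset.2 h, Finset.card_empty] at hN
        omega
      -- Every remaining edge is a bridge, so the minor is a forest.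
      have hb : ∀ e ∈ U, e ∉ T → ∀ x y : V(G), G.IsLink e x y →
          cmk G (U.erase e) x ≠ cmk G (U.erase e) y :=
        fun e heU heT x y he h => hcyc ⟨e, heU, heT, x, y, he, h⟩
      obtain ⟨e₀, he₀U, -⟩ := Finset.exists_of_ssubset hTU'
      obtain ⟨r, r', hr⟩ := G.exists_isLink_of_mem_edgeSet (hU he₀U)
      obtain ⟨e, heU, heT, x, y, he, -, hleaf⟩ := exists_leaf hU hTU' hb ⟨r, hr.left_mem⟩
      have hne : cmk G T x ≠ cmk G T y := fun h => hloop ⟨e, heU, heT, x, y, he, h⟩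
      have hTe : insert e T ⊆ U := Finset.insert_subset heU hTU
      have hv := card_comp_insert he hne
      have hcard := Finset.card_insert_of_notMem heT
      have hex := excess_insert_le he hne hTe
      obtain ⟨hc0, hc1⟩ := ih (T := insert e T) (U := U) hU hTe (by
        rw [Finset.sdiff_insert, Finset.card_erase_of_mem (Finset.mem_sdiff.2 ⟨heU, heT⟩), hN]
        rfl)
      constructor
      · intro I j h
        refine chromaticExact_of_leaf heT heU he hne hleaf fun k hk hkm hkj => hc0 _ _ ?_
        rintro ⟨h1, h2, h4⟩
        refine h ⟨by omega, by omega, ?_⟩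
        rw [hcard, Nat.cast_sub hkj] at h4
        rw [← hv]
        -- The contraction has one vertex fewer, which costs `m - 1` in the upper bound; the degree
        -- shift `k` is at most that.
        have hkm' : (k : ℤ) ≤ m - 1 := by omega
        push_cast at h4 ⊢
        linarith
      · intro I j h n hn
        exact chromaticExact_of_leaf heT heU he hne hleaf fun k hk hkm hkj =>
          hc1 _ _ (by omega) n hn

end Vanishing

/-! ### Comparison with the cohomology groups -/

section Comparison

variable {α β : Type*} [LinearOrder β] {G : Graph α β} [Finite V(G)] {m : ℕ}

theorem cubeD_eq_d {i : ℕ} (u : ∀ S, ChromaticModule G m S) (t : State G (i + 1)) :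
    cubeD (R := ℤ) (M := ChromaticModule G m) sign (chromaticMap G m) ∅ u t.1 =
      d G (TruncPoly m) i (fun s => u s.1) t := by
  rw [cubeD_apply, d_apply, Finset.sdiff_empty]
  refine (Finset.sum_coe_sort t.1 _).symm.trans (Finset.sum_congr rfl fun e _ => ?_)
  congr 1
  rw [chromaticMap, push_eq_incl (Finset.erase_subset _ _)]
  rfl

open Classical in
/-- Extension of a cochain by zero. -/
def extendCochain {i : ℕ} (c : Cochain G (TruncPoly m) i) (S : Finset β) : ChromaticModule G m S :=
  if h : (S : Set β) ⊆ E(G) ∧ S.card = i then c ⟨S, h⟩ else 0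

omit [LinearOrder β] [Finite V(G)] in
theorem extendCochain_apply {i : ℕ} (c : Cochain G (TruncPoly m) i) (s : State G i) :
    extendCochain c s.1 = c s := by
  rw [extendCochain, dif_pos s.2]

omit [LinearOrder β] in
theorem extendCochain_mem {i j : ℕ} {c : Cochain G (TruncPoly m) i}
    (hc : c ∈ cochainDegree G (truncGrading m) i j) (S : Finset β) :
    extendCochain c S ∈ chromaticDegree G m j S := by
  rw [extendCochain]
  split_ifs with h
  · exact hc ⟨S, h⟩ (Set.mem_univ _)
  · exact Submodule.zero_mem _

/-- The cochains of the cohomology groups live only on sets of a fixed size. Extended by zero they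
become families on all finite sets, and `CubeExact` tests only the relevant sizes. -/
theorem mem_coboundaries_of_chromaticExact {U : Finset β} (hU : (U : Set β) = E(G)) {i j : ℕ}
    {n : ℤ} (h : ChromaticExact G m ∅ U i j n) {z : Cochain G (TruncPoly m) i}
    (hz : z ∈ cocycles G (truncGrading m) i j)
    (hnz : n • z ∈ coboundaries G (truncGrading m) i j) :
    z ∈ coboundaries G (truncGrading m) i j := by
  have hdz : ∀ S, ∅ ⊆ S → S ⊆ U → (S.card : ℤ) = i + 1 →
      cubeD (R := ℤ) (M := ChromaticModule G m) sign (chromaticMap G m) ∅ (extendCochain z) S =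
        0 := by
    intro S _ hSU hS
    refine (cubeD_eq_d (extendCochain z)
      ⟨S, hU ▸ Finset.coe_subset.2 hSU, by exact_mod_cast hS⟩).trans ?_
    simp only [extendCochain_apply]
    exact congrFun (LinearMap.mem_ker.1 hz.2) _
  have hsmul : ∀ S : Finset β, ∀ h : (S : Set β) ⊆ E(G) ∧ S.card = i,
      n • extendCochain z S = (n • z) ⟨S, h⟩ := fun S h => by
    rw [show extendCochain z S = z ⟨S, h⟩ from extendCochain_apply z ⟨S, h⟩]
    rfl
  have hsub : ∀ t : State G i, t.1 ⊆ U := fun t => by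
    rw [← Finset.coe_subset, hU]
    exact t.2.1
  cases i with
  | zero =>
    have hnz' : n • z = 0 := hnz
    obtain ⟨u, -, hu⟩ := h (extendCochain z) 0 (extendCochain_mem hz.1)
      (fun S => Submodule.zero_mem _) hdz (by
        intro S _ hSU hS
        rw [map_zero, Pi.zero_apply, hsmul S ⟨hU ▸ Finset.coe_subset.2 hSU, by exact_mod_cast hS⟩,
          hnz', Pi.zero_apply])
    refine (Submodule.mem_bot ℤ).2 (funext fun t => ?_)
    rw [← extendCochain_apply z t, hu t.1 (Finset.empty_subset _) (hsub t)
      (by exact_mod_cast t.2.2), Pi.zero_apply]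
    -- At height zero there is no edge to remove, so the coboundary is zero, in accordance with the
    -- convention for `coboundaries`.
    refine cubeD_eq_zero fun e he _ => ?_
    rw [Finset.card_eq_zero.1 t.2.2] at he
    exact absurd he (Finset.notMem_empty e)
  | succ i =>
    obtain ⟨w, hw, hwz⟩ := hnz
    obtain ⟨u, huL, hu⟩ := h (extendCochain z) (extendCochain w) (extendCochain_mem hz.1)
      (extendCochain_mem hw) hdz (by
        intro S _ hSU hS
        have hS' : (S : Set β) ⊆ E(G) ∧ S.card = i + 1 :=
          ⟨hU ▸ Finset.coe_subset.2 hSU, by exact_mod_cast hS⟩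
        refine (hsmul S hS').trans (Eq.trans ?_ (cubeD_eq_d (extendCochain w) ⟨S, hS'⟩).symm)
        simp only [extendCochain_apply, hwz])
    refine ⟨fun s => u s.1, fun s _ => huL s.1, ?_⟩
    funext t
    rw [← cubeD_eq_d, ← hu t.1 (Finset.empty_subset _) (hsub t) (by exact_mod_cast t.2.2),
      extendCochain_apply]

theorem not_nontrivial_of_chromaticExact {U : Finset β} (hU : (U : Set β) = E(G)) {i j : ℕ}
    (h : ChromaticExact G m ∅ U i j 0) : ¬ Nontrivial (Cohomology G (truncGrading m) i j) := by
  rw [not_nontrivial_iff_subsingleton, Submodule.Quotient.subsingleton_iff, eq_top_iff]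
  intro z _
  refine mem_coboundaries_of_chromaticExact hU h z.2 ?_
  rw [zero_smul]
  exact Submodule.zero_mem _

theorem torsion_eq_bot_of_chromaticExact {U : Finset β} (hU : (U : Set β) = E(G)) {i j : ℕ}
    (h : ∀ n ≠ 0, ChromaticExact G m ∅ U i j n) :
    Submodule.torsion ℤ (Cohomology G (truncGrading m) i j) = ⊥ := by
  rw [eq_bot_iff]
  intro x hx
  obtain ⟨⟨n, hn⟩, hnx⟩ := (Submodule.mem_torsion_iff x).1 hx
  obtain ⟨z, rfl⟩ := Submodule.Quotient.mk_surjective _ x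
  have hnx' : n • (Submodule.Quotient.mk z : Cohomology G (truncGrading m) i j) = 0 := hnx
  rw [← Submodule.Quotient.mk_smul, Submodule.Quotient.mk_eq_zero] at hnx'
  rw [Submodule.mem_bot, Submodule.Quotient.mk_eq_zero]
  exact mem_coboundaries_of_chromaticExact hU (h n (nonZeroDivisors.ne_zero hn)) z.2 hnx'

omit [LinearOrder β] [Finite V(G)] in
theorem cmk_empty_injective : Function.Injective (cmk G ∅) := fun _ _ h =>
  eq_of_cmk_eq id (fun e he => absurd he (Finset.notMem_empty e)) h

omit [LinearOrder β] in
theorem card_comp_empty : Fintype.card (Comp G ∅) = Nat.card V(G) := by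
  rw [← Nat.card_eq_fintype_card]
  exact (Nat.card_eq_of_bijective _ ⟨cmk_empty_injective, exists_cmk⟩).symm

omit [LinearOrder β] in
theorem two_le_fiberCard {U : Finset β} (hU : (U : Set β) = E(G)) (hG : ∀ x, ¬ IsIsolated G x)
    (hloop : ∀ e x, ¬ G.IsLink e x x) (c : Comp G U) : 2 ≤ fiberCard G ∅ U c := by
  obtain ⟨x, rfl⟩ := exists_cmk c
  obtain ⟨e, y, he⟩ : ∃ e, G.Inc e x := by
    by_contra! h
    exact hG x ⟨x.2, h⟩
  have heU : e ∈ U := by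
    rw [← Finset.mem_coe, hU]
    exact he.edge_mem
  refine Finset.one_lt_card.2 ⟨cmk G ∅ x, ?_, cmk G ∅ ⟨y, he.right_mem⟩, ?_, fun h => ?_⟩
  · exact Finset.mem_filter.2 ⟨Finset.mem_univ _, push_cmk (Finset.empty_subset _) _⟩
  · refine Finset.mem_filter.2 ⟨Finset.mem_univ _, (push_cmk (Finset.empty_subset _) _).trans ?_⟩
    exact (cmk_eq_of_isLink (y := ⟨y, he.right_mem⟩) heU he).symm
  · have h1 : (x : α) = y := congrArg Subtype.val (cmk_empty_injective h)
    exact hloop e x (by rw [← h1] at he; exact he)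

-- Each vertex has an edge to a different vertex, so every component has at least two vertices and
-- the truncated subtractions in `excess` are exact.
omit [LinearOrder β] in
theorem excess_add {U : Finset β} (hU : (U : Set β) = E(G)) (hG : ∀ x, ¬ IsIsolated G x)
    (hloop : ∀ e x, ¬ G.IsLink e x x) :
    excess G ∅ U + 2 * Fintype.card (Comp G U) = Fintype.card (Comp G ∅) := by
  rw [← sum_fiberCard G ∅ U, excess, mul_comm, ← smul_eq_mul, ← Finset.card_univ,
    ← Finset.sum_const, ← Finset.sum_add_distrib]
  exact Finset.sum_congr rfl fun c _ => Nat.sub_add_cancel (two_le_fiberCard hU hG hloop c)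

end Comparison

end ChromaticCohomology

end

open ChromaticCohomology in
theorem mainTheorem5 {α β : Type*} [LinearOrder β] (G : Graph α β) [Finite V(G)] [Finite E(G)]
    (v μ : ℕ) (hv : Nat.card V(G) = v) (hμ : Nat.card (Component G) = μ)
    (hG : ∀ x, ¬ IsIsolated G x) (m i j : ℕ) :
    (Nontrivial (Cohomology G (truncGrading m) i j) →
      (0 ≤ (i : ℤ) ∧ (i : ℤ) ≤ (v : ℤ) - 2 * μ) ∧
      (v : ℤ) - μ ≤ (i : ℤ) + j ∧
      ((m : ℤ) - 1) * i + j ≤ ((m : ℤ) - 1) * v) ∧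
    (Submodule.torsion ℤ (Cohomology G (truncGrading m) i j) ≠ ⊥ →
      (1 ≤ (i : ℤ) ∧ (i : ℤ) ≤ (v : ℤ) - 2 * μ) ∧
      (v : ℤ) + 1 - μ ≤ (i : ℤ) + j ∧
      ((m : ℤ) - 1) * i + j ≤ ((m : ℤ) - 1) * v) := by
  obtain ⟨U, hU⟩ := (Set.toFinite E(G)).exists_finset_coe
  -- A loop kills all cohomology. It is treated first because a vertex carrying only loops is not
  -- isolated, yet forms a component with one vertex.
  by_cases hloop : ∃ e x, G.IsLink e x x
  · obtain ⟨e, x, he⟩ := hloop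
    have heU : e ∈ U := by
      rw [← Finset.mem_coe, hU]
      exact he.edge_mem
    have hex : ∀ n, ChromaticExact G m ∅ U i j n := fun n =>
      chromaticExact_of_loop (x₀ := ⟨x, he.left_mem⟩) (y₀ := ⟨x, he.left_mem⟩)
        (Finset.notMem_empty e) heU he rfl
    exact ⟨fun h => absurd h (not_nontrivial_of_chromaticExact hU (hex 0)),
      fun h => absurd (torsion_eq_bot_of_chromaticExact hU fun n _ => hex n) h⟩
  · push Not at hloop
    have hv' : Fintype.card (Comp G ∅) = v := card_comp_empty.trans hv
    have hμ' : Fintype.card (Comp G U) = μ := by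
      rw [← Nat.card_eq_fintype_card, ← hμ, Comp, hU, Graph.restrict_self]
    have hexc := excess_add hU hG hloop
    rw [hv', hμ'] at hexc
    obtain ⟨h0, h1⟩ := chromaticExact_of_not_inRange (m := m) hU.le (Finset.empty_subset U)
    have part1 : Nontrivial (Cohomology G (truncGrading m) i j) →
        (0 ≤ (i : ℤ) ∧ (i : ℤ) ≤ (v : ℤ) - 2 * μ) ∧ (v : ℤ) - μ ≤ (i : ℤ) + j ∧
        ((m : ℤ) - 1) * i + j ≤ ((m : ℤ) - 1) * v := by
      intro h
      have hr : InRange G m ∅ U i j := by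
        by_contra hr
        exact not_nontrivial_of_chromaticExact hU (h0 i j hr) h
      obtain ⟨h2, h3, h4⟩ := hr
      rw [hv', hμ', Finset.card_empty] at h3
      rw [hv', Finset.card_empty, Nat.cast_zero, sub_zero] at h4
      rw [Finset.card_empty] at h2
      exact ⟨⟨by omega, by omega⟩, by omega, h4⟩
    refine ⟨part1, fun h => ?_⟩
    have hnt : Nontrivial (Cohomology G (truncGrading m) i j) := by
      by_contra hnt
      rw [not_nontrivial_iff_subsingleton] at hnt
      exact h (Subsingleton.elim _ _)
    obtain ⟨⟨-, h2⟩, -, h4⟩ := part1 hnt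
    refine ⟨⟨?_, h2⟩, ?_, h4⟩
    · by_contra hi
      obtain rfl : i = 0 := by omega
      -- In height zero there are no coboundaries, and the cocycles lie in a free module.
      exact h (torsion_eq_bot_of_chromaticExact hU fun n hn => chromaticExact_of_card_eq hn)
    · by_contra hij
      refine h (torsion_eq_bot_of_chromaticExact hU (h1 i j ?_))
      rw [hv', hμ', Finset.card_empty]
      omega
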